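/- **Setting.** An operational theory (in the circuit framework) consists of system types with sequential and parallel composition (a symmetric monoidal category), processes with finitely many classical outcomes (tests), closed under sequential and parallel composition and coarse-graining, and a probability for every closed circuit; outcomes of processes that give the same probabilities in all closed circuits are identified. States are deterministic preparations; a state is *pure* if it arises as a coarse-graining of a preparation process only trivially (every outcome is proportional to it); a *reversible* transformation is an invertible process; $|s_1),\dots,|s_n)$ are *perfectly distinguishable* if there is a measurement $\{(e_j|\}_{j=1}^n$ with $(e_j|s_i)=\delta_{ij}$. Assume that the state spaces are closed and span finite-dimensional real vector spaces, that later processes may be chosen depending on earlier outcomes (classical control), that every mathematically well-defined measurement (finite family of linear functionals that are nonnegative on states and sum to $1$ on states) is physical (no restriction), and that products of pure states are pure. Assume moreover * *Causality*: every system has a unique deterministic effect, and it is the sum of the effects of every measurement; * *Purification*: every state of $A$ is the marginal of a pure state of some $A\otimes B$, and two pure states of $A\otimes B$ with the same marginal on $A$ differ by a reversible transformation of $B$; * *Strong symmetry*: any two $n$-tuples of pure perfectly distinguishable states of a system are related by a reversible transformation of that system. **Lemma (generalised kick-back).** Let $\{|i)\}$ be a finite maximal set of pure and perfectly distinguishable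 states of a system $A$ (no further pure state can be added so that the enlarged set is still perfectly distinguishable), let $\{T_i\}$ be transformations of a system $B$, and let $C\{T_i\}$ be a reversible controlled transformation, i.e. a reversible transformation of $A\otimes B$ with $$C\{T_i\}\big(|i)\otimes|\sigma)\big)=|i)\otimes T_i|\sigma)\qquad\text{for all } i \text{ and all states } |\sigma) \text{ of } B.$$ Let $|s)$ be a pure state of $B$ with $T_i|s)=|s)$ for all $i$. Then there is a reversible transformation $Q_s$ of $A$ such that $$C\{T_i\}\big(|\sigma)\otimes|s)\big)=\big(Q_s|\sigma)\big)\otimes|s)\qquad\text{for all states } |\sigma) \text{ of } A.$$ Moreover $Q_s$ is a phase transformation: $(i|\,Q_s=(i|$ for all $i$, for every measurement $\{(i|\}$ that perfectly distinguishes the control states, i.e. $(j|i)=\delta_{ij}$. -/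

import Mathlib

open CategoryTheory MonoidalCategory

universe v u

/-- An operational physical theory in the circuit framework.  Objects of the symmetric monoidal
category `𝒞` are system types, `⊗` is parallel composition and `≫` sequential composition.
A morphism `A ⟶ B` is one outcome (pointer position) of a process from `A` to `B`;
`IsTest f` says that the finite family `f` is the complete family of outcomes of one process.
`prob` is the probability of a closed circuit. -/
class OperationalTheory (𝒞 : Type u) [Category.{v} 𝒞] [MonoidalCategory 𝒞]
    [SymmetricCategory 𝒞] where
  /-- the probability assigned to a closed circuit -/
  prob : (𝟙_ 𝒞 ⟶ 𝟙_ 𝒞) → ℝ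
  /-- the family is the family of all outcomes of one process -/
  IsTest : ∀ {A B : 𝒞} {ι : Type} [Finite ι], (ι → (A ⟶ B)) → Prop
  prob_nonneg : ∀ p : 𝟙_ 𝒞 ⟶ 𝟙_ 𝒞, 0 ≤ prob p
  prob_id : prob (𝟙 (𝟙_ 𝒞)) = 1
  prob_comp : ∀ p q : 𝟙_ 𝒞 ⟶ 𝟙_ 𝒞, prob (p ≫ q) = prob p * prob q
  /-- the outcomes of a closed experiment have total probability one -/
  sum_prob : ∀ {ι : Type} [Fintype ι] (p : ι → (𝟙_ 𝒞 ⟶ 𝟙_ 𝒞)), IsTest p → ∑ i, prob (p i) = 1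
  /-- processes with the same probabilities in all closed circuits are identified -/
  eq_of_prob_eq : ∀ {A B : 𝒞} (f g : A ⟶ B),
    (∀ (E : 𝒞) (ρ : 𝟙_ 𝒞 ⟶ A ⊗ E) (e : B ⊗ E ⟶ 𝟙_ 𝒞),
      prob (ρ ≫ f ▷ E ≫ e) = prob (ρ ≫ g ▷ E ≫ e)) → f = g
  exists_isTest : ∀ {A B : 𝒞} (f : A ⟶ B),
    ∃ (n : ℕ) (t : Fin n → (A ⟶ B)) (k : Fin n), IsTest t ∧ t k = f
  isTest_id : ∀ A : 𝒞, IsTest (fun _ : Unit => 𝟙 A)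
  isTest_comp : ∀ {A B D : 𝒞} {ι κ : Type} [Finite ι] [Finite κ]
    (f : ι → (A ⟶ B)) (g : κ → (B ⟶ D)), IsTest f → IsTest g →
      IsTest (fun x : ι × κ => f x.1 ≫ g x.2)
  isTest_tensor : ∀ {A B A' B' : 𝒞} {ι κ : Type} [Finite ι] [Finite κ]
    (f : ι → (A ⟶ B)) (g : κ → (A' ⟶ B')), IsTest f → IsTest g →
      IsTest (fun x : ι × κ => f x.1 ⊗ₘ g x.2)
  /-- every process has a coarse-graining along every partition of its outcomes -/
  exists_coarse : ∀ {A B : 𝒞} {ι κ : Type} [Fintype ι] [Finite κ] [DecidableEq κ]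
    (f : ι → (A ⟶ B)) (π : ι → κ), Function.Surjective π → IsTest f →
      ∃ g : κ → (A ⟶ B), IsTest g ∧
        ∀ (k : κ) (E : 𝒞) (ρ : 𝟙_ 𝒞 ⟶ A ⊗ E) (e : B ⊗ E ⟶ 𝟙_ 𝒞),
          prob (ρ ≫ g k ▷ E ≫ e) =
            ∑ i ∈ Finset.univ.filter (fun i => π i = k), prob (ρ ≫ f i ▷ E ≫ e)

namespace OperationalTheory

section

variable {𝒞 : Type u} [Category.{v} 𝒞] [MonoidalCategory 𝒞] [SymmetricCategory 𝒞]
  [OperationalTheory 𝒞]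

/-- `g = ∑ i, f i`, as probabilities in all closed circuits. -/
def IsSum {A B : 𝒞} {ι : Type} [Fintype ι] (f : ι → (A ⟶ B)) (g : A ⟶ B) : Prop :=
  ∀ (E : 𝒞) (ρ : 𝟙_ 𝒞 ⟶ A ⊗ E) (e : B ⊗ E ⟶ 𝟙_ 𝒞),
    prob (ρ ≫ g ▷ E ≫ e) = ∑ i, prob (ρ ≫ f i ▷ E ≫ e)

/-- A process with a single outcome. -/
def IsDeterministic {A B : 𝒞} (f : A ⟶ B) : Prop :=
  IsTest (fun _ : Unit => f)

/-- A (normalised) state. -/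
def IsState {A : 𝒞} (s : 𝟙_ 𝒞 ⟶ A) : Prop :=
  IsDeterministic s

/-- A state is pure if it arises as a coarse-graining of a preparation process only trivially:
each outcome of the process is proportional to it. -/
def IsPure {A : 𝒞} (s : 𝟙_ 𝒞 ⟶ A) : Prop :=
  IsState s ∧ ∀ (ι : Type) [Fintype ι] (r : ι → (𝟙_ 𝒞 ⟶ A)), IsTest r → IsSum r s →
    ∀ i, ∃ c : ℝ, ∀ e : A ⟶ 𝟙_ 𝒞, prob (r i ≫ e) = c * prob (s ≫ e)

/-- The product `|s) ⊗ |t)` of two states. -/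
def prodState {A B : 𝒞} (s : 𝟙_ 𝒞 ⟶ A) (t : 𝟙_ 𝒞 ⟶ B) : 𝟙_ 𝒞 ⟶ A ⊗ B :=
  (λ_ (𝟙_ 𝒞)).inv ≫ (s ⊗ₘ t)

/-- `s` is the marginalisation of `ψ` on the first system: the second system is discarded by
the deterministic effect. -/
def IsMarginal {A B : 𝒞} (ψ : 𝟙_ 𝒞 ⟶ A ⊗ B) (s : 𝟙_ 𝒞 ⟶ A) : Prop :=
  ∀ d : B ⟶ 𝟙_ 𝒞, IsDeterministic d → ψ ≫ A ◁ d ≫ (ρ_ A).hom = s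

/-- The measurement `e` perfectly distinguishes the states `s i`: `(e j| s i) = δ_{ij}`. -/
def Distinguishes {A : 𝒞} {ι : Type} [Finite ι] (e : ι → (A ⟶ 𝟙_ 𝒞))
    (s : ι → (𝟙_ 𝒞 ⟶ A)) : Prop :=
  IsTest e ∧ (∀ i, prob (s i ≫ e i) = 1) ∧ ∀ i j, i ≠ j → prob (s i ≫ e j) = 0

/-- A tuple of pure and perfectly distinguishable states. -/
def IsPureDistinguishable {A : 𝒞} {ι : Type} [Finite ι] (s : ι → (𝟙_ 𝒞 ⟶ A)) : Prop :=
  (∀ i, IsPure (s i)) ∧ ∃ e : ι → (A ⟶ 𝟙_ 𝒞), Distinguishes e s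

/-- A tuple of pure and perfectly distinguishable states to which no further pure state
can be added. -/
def IsMaximalPureDistinguishable {A : 𝒞} {ι : Type} [Finite ι] (s : ι → (𝟙_ 𝒞 ⟶ A)) : Prop :=
  IsPureDistinguishable s ∧
    ¬ ∃ t : 𝟙_ 𝒞 ⟶ A, IsPureDistinguishable (fun o : Option ι => o.elim t s)

/-- `c` is a controlled transformation `C{T_i}` for the control states `|i)`:
it maps `|i) ⊗ |σ)` to `|i) ⊗ T_i |σ)`. -/
def IsControlled {A B : 𝒞} {ι : Type} (i : ι → (𝟙_ 𝒞 ⟶ A)) (T : ι → (B ⟶ B))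
    (c : A ⊗ B ⟶ A ⊗ B) : Prop :=
  ∀ (k : ι) (σ : 𝟙_ 𝒞 ⟶ B), IsState σ →
    prodState (i k) σ ≫ c = prodState (i k) (σ ≫ T k)

/-- A reversible transformation is a phase transformation relative to the effects `e i`
if it leaves each of them unchanged. -/
def IsPhaseTransformation {A : 𝒞} {ι : Type} (e : ι → (A ⟶ 𝟙_ 𝒞)) (Q : A ≅ A) : Prop :=
  ∀ i, Q.hom ≫ e i = e i

/-- The vector of a state: its probabilities for all effects. -/
def stateVec {A : 𝒞} (s : 𝟙_ 𝒞 ⟶ A) : (A ⟶ 𝟙_ 𝒞) → ℝ :=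
  fun e => prob (s ≫ e)

/-- The set `Ω_A` of states of `A`, in the real vector space it lives in. -/
def stateSpace (A : 𝒞) : Set ((A ⟶ 𝟙_ 𝒞) → ℝ) :=
  {x | ∃ s : 𝟙_ 𝒞 ⟶ A, IsState s ∧ x = stateVec s}

end

section

variable (𝒞 : Type u) [Category.{v} 𝒞] [MonoidalCategory 𝒞] [SymmetricCategory 𝒞]
  [OperationalTheory 𝒞]

/-- The state spaces span finite-dimensional vector spaces. -/
def FiniteDimensionalStates : Prop :=
  ∀ A : 𝒞, FiniteDimensional ℝ (Submodule.span ℝ (stateSpace A))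

/-- The state spaces are topologically closed (closure under operational limits). -/
def ClosedStates : Prop :=
  ∀ A : 𝒞, IsClosed (stateSpace A)

/-- The composite of two pure states is pure. -/
def PureProducts : Prop :=
  ∀ (A B : 𝒞) (s : 𝟙_ 𝒞 ⟶ A) (t : 𝟙_ 𝒞 ⟶ B), IsPure s → IsPure t → IsPure (prodState s t)

/-- Causality: a unique deterministic effect for every system, equal to the sum of the effects
of every measurement. -/
def Causal : Prop :=
  ∀ A : 𝒞, ∃ d : A ⟶ 𝟙_ 𝒞, IsDeterministic d ∧
    (∀ d' : A ⟶ 𝟙_ 𝒞, IsDeterministic d' → d' = d) ∧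
    ∀ (ι : Type) [Fintype ι] (e : ι → (A ⟶ 𝟙_ 𝒞)), IsTest e → IsSum e d

/-- Classical control: which process is performed next may depend on an earlier outcome. -/
def ClassicalControl : Prop :=
  ∀ (A B D : 𝒞) (ι : Type) [Finite ι] (κ : ι → Type) [∀ i, Finite (κ i)]
    (f : ι → (A ⟶ B)) (g : ∀ i, κ i → (B ⟶ D)), IsTest f → (∀ i, IsTest (g i)) →
      IsTest (fun x : (i : ι) × κ i => f x.1 ≫ g x.1 x.2)

/-- No restriction: every mathematically well-defined measurement, i.e. every finite family of
linear functionals that are nonnegative on states and sum to one on states, is physical. -/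
def NoRestriction : Prop :=
  ∀ (A : 𝒞) (ι : Type) [Fintype ι] (a : ι → (((A ⟶ 𝟙_ 𝒞) → ℝ) →ₗ[ℝ] ℝ)),
    (∀ x ∈ stateSpace A, (∀ i, 0 ≤ a i x) ∧ ∑ i, a i x = 1) →
      ∃ e : ι → (A ⟶ 𝟙_ 𝒞), IsTest e ∧
        ∀ (s : 𝟙_ 𝒞 ⟶ A), IsState s → ∀ i, prob (s ≫ e i) = a i (stateVec s)

/-- Purification: every state is the marginal of a pure state, and two pure states with equal
marginals differ by a reversible transformation on the purifying system. -/
def Purification : Prop :=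
  (∀ (A : 𝒞) (s : 𝟙_ 𝒞 ⟶ A), IsState s →
    ∃ (B : 𝒞) (ψ : 𝟙_ 𝒞 ⟶ A ⊗ B), IsPure ψ ∧ IsMarginal ψ s) ∧
  ∀ (A B : 𝒞) (s : 𝟙_ 𝒞 ⟶ A) (ψ ψ' : 𝟙_ 𝒞 ⟶ A ⊗ B), IsPure ψ → IsPure ψ' →
    IsMarginal ψ s → IsMarginal ψ' s → ∃ T : B ≅ B, ψ' = ψ ≫ A ◁ T.hom

/-- Strong symmetry: any two `n`-tuples of pure and perfectly distinguishable states of a system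
are related by a reversible transformation. -/
def StrongSymmetry : Prop :=
  ∀ (A : 𝒞) (n : ℕ) (s t : Fin n → (𝟙_ 𝒞 ⟶ A)),
    IsPureDistinguishable s → IsPureDistinguishable t →
      ∃ T : A ≅ A, ∀ i, s i ≫ T.hom = t i

end

end OperationalTheory

/-! ### Compact convex sets: extreme points and the cone they generate -/

namespace ConvexBody

open MeasureTheory

variable {V : Type*} [NormedAddCommGroup V] [InnerProductSpace ℝ V] [FiniteDimensional ℝ V]

/-! The control states of a maximal set average to a completely mixed state μ. Since the controlled
transformation fixes every |i) ⊗ |s), linearity makes it fix μ ⊗ s. Let Ψ on A ⊗ E purify μ.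
Adjoining s to Ψ gives a pure state, and applying C afterwards does not change its marginal μ ⊗ s on
A ⊗ B. By purification a channel on E alone carries the first state to the second, so s is still a
separate factor of the output. Because Ψ is dynamically faithful (`hom_ext_of_faithful`), the
factorisation holds for every input (`exists_kickback`). The same argument for the inverse of C
inverts Q.

The main work is the claim about the average. Strong symmetry for single states and for pairs makes
the symmetries of the state space Ω transitive on extreme points and on separated pairs of them. By
the argument of Müller and Ududec the cone over Ω is then self-dual (`exists_isSelfDualizing`): an
invariant inner product exists, and subtracting a multiple of u ⊗ u, where u is the unit functional,
makes distinguishable pure states orthogonal. The vector y representing u is proportional to a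
completely mixed state. Purification lets a two-outcome measurement be performed without disturbing
states on which its first outcome is certain (`exists_compression`). With self-duality this shows
that sums of orthogonal pure states stay below y (`sub_sum_nonneg`). A nonzero remainder would
supply one more distinguishable pure state, against maximality, so the control states sum exactly to
y (`sum_maximal_eq`).

For the phase property, Q fixes each |i). A nonnegative functional equal to 1 at |k) and to 0 at the
other control states has value 1 on y, and self-duality leaves only one such functional
(`eq_of_apply_eq_one`). Both (k| and (k|Q qualify. -/

theorem continuous_linear (f : V →ₗ[ℝ] ℝ) : Continuous f :=
  f.continuous_of_finiteDimensional

theorem exists_riesz (f : V →ₗ[ℝ] ℝ) : ∃ w : V, ∀ x, f x = inner ℝ w x := by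
  refine ⟨(InnerProductSpace.toDual ℝ V).symm (LinearMap.toContinuousLinearMap f), fun x => ?_⟩
  rw [InnerProductSpace.toDual_symm_apply]; rfl

/-- The set of minimizers of a linear functional is a face. -/
theorem isExtreme_minimizers (Ω : Set V) (f : V →ₗ[ℝ] ℝ) :
    IsExtreme ℝ Ω {x ∈ Ω | ∀ y ∈ Ω, f x ≤ f y} := by
  have : IsExposed ℝ Ω {x ∈ Ω | ∀ y ∈ Ω, f x ≤ f y} := by
    intro _
    refine ⟨-(LinearMap.toContinuousLinearMap f), ?_⟩
    ext x
    simp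
  exact this.isExtreme

theorem exists_extreme_minimizer {Ω : Set V} (hc : IsCompact Ω) (hne : Ω.Nonempty)
    (f : V →ₗ[ℝ] ℝ) : ∃ a ∈ Ω.extremePoints ℝ, ∀ x ∈ Ω, f a ≤ f x := by
  obtain ⟨x₀, hx₀, hmin⟩ := hc.exists_isMinOn hne (continuous_linear f).continuousOn
  have hF := isExtreme_minimizers Ω f
  have hFc : IsCompact {x ∈ Ω | ∀ y ∈ Ω, f x ≤ f y} := by
    have : {x ∈ Ω | ∀ y ∈ Ω, f x ≤ f y} = Ω ∩ {x | f x ≤ f x₀} := by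
      ext x
      constructor
      · rintro ⟨h1, h2⟩; exact ⟨h1, h2 x₀ hx₀⟩
      · rintro ⟨h1, h2⟩; exact ⟨h1, fun y hy => le_trans h2 (hmin hy)⟩
    rw [this]
    exact hc.inter_right (isClosed_le (continuous_linear f) continuous_const)
  obtain ⟨a, ha⟩ := hFc.extremePoints_nonempty ⟨x₀, hx₀, fun y hy => hmin hy⟩
  exact ⟨a, hF.extremePoints_subset_extremePoints ha, ha.1.2⟩

theorem exists_extreme_maximizer {Ω : Set V} (hc : IsCompact Ω) (hne : Ω.Nonempty)
    (f : V →ₗ[ℝ] ℝ) : ∃ a ∈ Ω.extremePoints ℝ, ∀ x ∈ Ω, f x ≤ f a := by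
  obtain ⟨a, ha, h⟩ := exists_extreme_minimizer hc hne (-f)
  exact ⟨a, ha, fun x hx => by simpa using h x hx⟩

/-- A linear functional attains its minimum over a compact set at an extreme point; convexity plays
no role. -/
theorem le_of_le_on_extreme {Ω : Set V} (hc : IsCompact Ω) (f g : V →ₗ[ℝ] ℝ)
    (h : ∀ a ∈ Ω.extremePoints ℝ, f a ≤ g a) : ∀ x ∈ Ω, f x ≤ g x := by
  intro x hx
  obtain ⟨a, ha, hm⟩ := exists_extreme_minimizer hc ⟨x, hx⟩ (g - f)
  have := hm x hx
  have h2 := h a ha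
  simp only [LinearMap.sub_apply] at this
  linarith

theorem eq_of_eq_on_extreme {Ω : Set V} (hc : IsCompact Ω) (hs : Submodule.span ℝ Ω = ⊤)
    (f g : V →ₗ[ℝ] ℝ) (h : ∀ a ∈ Ω.extremePoints ℝ, f a = g a) : f = g :=
  LinearMap.ext_on hs fun x hx =>
    le_antisymm (le_of_le_on_extreme hc f g (fun a ha => (h a ha).le) x hx)
      (le_of_le_on_extreme hc g f (fun a ha => (h a ha).ge) x hx)

theorem exists_bound {Ω : Set V} (hc : IsCompact Ω) (f : V →ₗ[ℝ] ℝ) :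
    ∃ K : ℝ, 0 < K ∧ ∀ x ∈ Ω, |f x| ≤ K := by
  obtain ⟨K, hK⟩ := hc.exists_bound_of_continuousOn (continuous_linear f).continuousOn
  exact ⟨max K 1, by positivity, fun x hx => le_trans (hK x hx) (le_max_left _ _)⟩

/-- A vector on which all functionals that are nonnegative on `Ω` are nonnegative
lies in the cone over `Ω`. -/
theorem mem_cone_of_forall_nonneg {Ω : Set V} (hc : IsCompact Ω) (hcv : Convex ℝ Ω)
    (hne : Ω.Nonempty) (u : V →ₗ[ℝ] ℝ) (hu : ∀ x ∈ Ω, u x = 1) (m : V)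
    (hm : ∀ f : V →ₗ[ℝ] ℝ, (∀ x ∈ Ω, 0 ≤ f x) → 0 ≤ f m) :
    ∃ c : ℝ, 0 ≤ c ∧ ∃ x ∈ Ω, m = c • x := by
  have hum : 0 ≤ u m := hm u fun x hx => by rw [hu x hx]; exact zero_le_one
  rcases hum.eq_or_lt with h0 | hpos
  · obtain ⟨x, hx⟩ := hne
    refine ⟨0, le_rfl, x, hx, ?_⟩
    rw [zero_smul]
    -- Adding a large multiple of `u` makes any `f` nonnegative on `Ω` without changing its value at
    -- `m`, because `u m = 0`. Taking `f` to be minus the pairing with `m` then forces `m = 0`.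
    have h : ∀ f : V →ₗ[ℝ] ℝ, 0 ≤ f m := by
      intro f
      obtain ⟨K, -, hK⟩ := exists_bound hc f
      have := hm (f + K • u) fun x hx => by
        have := neg_le_of_abs_le (hK x hx)
        simp [hu x hx]; linarith
      simpa [← h0] using this
    have := h (-(innerₗ V m))
    simp only [LinearMap.neg_apply, innerₗ_apply_apply, real_inner_self_eq_norm_sq] at this
    have : ‖m‖ = 0 := by nlinarith [sq_nonneg ‖m‖]
    exact norm_eq_zero.mp this
  · refine ⟨u m, hum, (u m)⁻¹ • m, ?_, by rw [smul_inv_smul₀ hpos.ne']⟩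
    by_contra hnot
    -- Since `u = 1` on `Ω`, the affine separation `f > s` becomes nonnegativity of the linear
    -- functional `f - s • u`.
    obtain ⟨f, s, hfs, hsf⟩ := geometric_hahn_banach_point_closed hcv hc.isClosed hnot
    have := hm ((f : V →ₗ[ℝ] ℝ) - s • u) fun x hx => by
      have := hsf x hx
      simp [hu x hx]; linarith
    simp only [map_smul, smul_eq_mul] at hfs
    rw [inv_mul_lt_iff₀ hpos] at hfs
    simp at this
    linarith

end ConvexBody

/-! ### An inner product invariant under all symmetries -/

namespace ConvexBody

open MeasureTheory

section

variable {V : Type*} [NormedAddCommGroup V] [InnerProductSpace ℝ V]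

/-- The absolute polar of a set. -/
def polarBody (Ω : Set V) : Set V := {v | ∀ x ∈ Ω, |inner ℝ v x| ≤ 1}

theorem isClosed_polarBody (Ω : Set V) : IsClosed (polarBody Ω) := by
  have : polarBody Ω = ⋂ x ∈ Ω, {v : V | |inner ℝ v x| ≤ 1} := by
    ext v; simp [polarBody]
  rw [this]
  refine isClosed_biInter fun x _ => isClosed_le ?_ continuous_const
  fun_prop

theorem exists_ball_subset_polarBody {Ω : Set V} (hc : IsCompact Ω) :
    ∃ ε : ℝ, 0 < ε ∧ Metric.ball (0 : V) ε ⊆ polarBody Ω := by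
  obtain ⟨R, hR, hΩ⟩ := hc.isBounded.exists_pos_norm_le
  refine ⟨R⁻¹, inv_pos.mpr hR, fun v hv x hx => ?_⟩
  rw [mem_ball_zero_iff] at hv
  calc |inner ℝ v x| ≤ ‖v‖ * ‖x‖ := abs_real_inner_le_norm v x
    _ ≤ R⁻¹ * R := by gcongr; exact hΩ x hx
    _ = 1 := inv_mul_cancel₀ hR.ne'

variable [FiniteDimensional ℝ V]

/-- Pairing with a basis chosen inside `Ω` is an injective linear map that sends the polar into the
unit cube, and such a map is bounded below. -/
theorem isCompact_polarBody {Ω : Set V} (hs : Submodule.span ℝ Ω = ⊤) :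
    IsCompact (polarBody Ω) := by
  refine Metric.isCompact_of_isClosed_isBounded (isClosed_polarBody Ω) ?_
  obtain ⟨b, hbs, hbspan, hbli⟩ := exists_linearIndependent ℝ Ω
  have : Fintype b := (hbli.setFinite).fintype
  let L : V →ₗ[ℝ] (b → ℝ) := LinearMap.pi fun i => innerₗ V (i : V)
  have hinj : LinearMap.ker L = ⊥ := by
    rw [LinearMap.ker_eq_bot']
    intro v hv
    have h0 : innerₗ V v = 0 := by
      refine LinearMap.ext_on (hbspan.trans hs) fun x hx => ?_
      have := congrFun hv ⟨x, hx⟩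
      simp only [L, LinearMap.pi_apply, innerₗ_apply_apply, Pi.zero_apply] at this
      simpa [real_inner_comm] using this
    have := LinearMap.congr_fun h0 v
    simpa using this
  obtain ⟨K, -, hK⟩ := L.exists_antilipschitzWith hinj
  have hbd : Bornology.IsBounded (L ⁻¹' Metric.closedBall 0 1) :=
    hK.isBounded_preimage Metric.isBounded_closedBall
  refine hbd.subset fun v hv => ?_
  rw [Set.mem_preimage, mem_closedBall_zero_iff, pi_norm_le_iff_of_nonneg zero_le_one]
  intro i
  have := hv i (hbs i.2)
  simpa [L, real_inner_comm] using this

theorem adjoint_image_polarBody {Ω : Set V} (g : V ≃ₗ[ℝ] V) (hg : g '' Ω = Ω) :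
    LinearMap.adjoint (g : V →ₗ[ℝ] V) '' polarBody Ω = polarBody Ω := by
  have key : ∀ h : V ≃ₗ[ℝ] V, h '' Ω = Ω → ∀ v ∈ polarBody Ω,
      LinearMap.adjoint (h : V →ₗ[ℝ] V) v ∈ polarBody Ω := by
    intro h hh v hv x hx
    rw [LinearMap.adjoint_inner_left]
    exact hv _ (hh ▸ Set.mem_image_of_mem h hx)
  apply Set.Subset.antisymm
  · rintro _ ⟨v, hv, rfl⟩
    exact key g hg v hv
  · intro v hv
    have hg' : g.symm '' Ω = Ω := by
      conv_lhs => rw [← hg]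
      rw [← Set.image_comp]; simp
    refine ⟨_, key g.symm hg' v hv, ?_⟩
    refine ext_inner_right ℝ fun x => ?_
    rw [LinearMap.adjoint_inner_left, LinearMap.adjoint_inner_left]
    simp

/-- The symmetry group of a compact spanning set preserves an inner product. -/
theorem exists_invariant_form {Ω : Set V} (hc : IsCompact Ω)
    (hs : Submodule.span ℝ Ω = ⊤) :
    ∃ β : V →ₗ[ℝ] V →ₗ[ℝ] ℝ, (∀ x y, β x y = β y x) ∧ (∀ x, 0 ≤ β x x) ∧
      (∀ x, β x x = 0 → x = 0) ∧
      ∀ g : V ≃ₗ[ℝ] V, g '' Ω = Ω → ∀ x y, β (g x) (g y) = β x y := by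
  let _ : MeasurableSpace V := borel V
  have _ : BorelSpace V := ⟨rfl⟩
  have hS := isCompact_polarBody hs
  have hSm : MeasurableSet (polarBody Ω) := (isClosed_polarBody Ω).measurableSet
  obtain ⟨ε, hε, hball⟩ := exists_ball_subset_polarBody hc
  let vol : Measure V := Measure.addHaar
  have hpos : 0 < vol.real (polarBody Ω) := by
    rw [Measure.real, ENNReal.toReal_pos_iff]
    exact ⟨lt_of_lt_of_le (Metric.measure_ball_pos vol 0 hε) (measure_mono hball),
      hS.measure_lt_top⟩
  have hint : ∀ x y : V, IntegrableOn (fun v : V => inner ℝ v x * inner ℝ v y)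
      (polarBody Ω) vol := fun x y =>
    ContinuousOn.integrableOn_compact hS (by fun_prop)
  -- The second-moment form of the polar body replaces an average over the symmetry group: adjoints
  -- of symmetries permute the polar body.
  let β : V →ₗ[ℝ] V →ₗ[ℝ] ℝ := LinearMap.mk₂ ℝ
    (fun x y => ∫ v in polarBody Ω, inner ℝ v x * inner ℝ v y ∂vol)
    (fun x x' y => by
      rw [← integral_add (hint x y) (hint x' y)]
      simp only [inner_add_right, add_mul])
    (fun c x y => by
      rw [smul_eq_mul, ← integral_const_mul]
      simp only [inner_smul_right, mul_assoc])
    (fun x y y' => by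
      rw [← integral_add (hint x y) (hint x y')]
      simp only [inner_add_right, mul_add])
    (fun c x y => by
      rw [smul_eq_mul, ← integral_const_mul]
      simp only [inner_smul_right]
      congr 1; ext v; ring)
  have hβ : ∀ x y, β x y = ∫ v in polarBody Ω, inner ℝ v x * inner ℝ v y ∂vol :=
    fun x y => rfl
  have hcv : ∀ g : V ≃ₗ[ℝ] V, g '' Ω = Ω → ∀ h : V → ℝ,
      ∫ v in polarBody Ω, h v ∂vol =
        |LinearMap.det (LinearMap.adjoint (g : V →ₗ[ℝ] V))| *
          ∫ v in polarBody Ω, h (LinearMap.adjoint (g : V →ₗ[ℝ] V) v) ∂vol := by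
    intro g hg h
    set T := LinearMap.adjoint (g : V →ₗ[ℝ] V) with hT
    have hTinj : Function.Injective T := by
      intro a b hab
      refine ext_inner_right ℝ fun x => ?_
      have := congrArg (fun w => inner ℝ w (g.symm x)) hab
      simpa [hT, LinearMap.adjoint_inner_left] using this
    conv_lhs => rw [← adjoint_image_polarBody g hg]
    rw [integral_image_eq_integral_abs_det_fderiv_smul vol hSm (f := T)
      (f' := fun _ => LinearMap.toContinuousLinearMap T)
      (fun x _ => (LinearMap.toContinuousLinearMap T).hasFDerivWithinAt) hTinj.injOn]
    simp only [LinearMap.det_toContinuousLinearMap, smul_eq_mul]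
    rw [integral_const_mul]
  refine ⟨β, fun x y => ?_, fun x => ?_, fun x hx => ?_, fun g hg x y => ?_⟩
  · simp only [hβ, mul_comm]
  · rw [hβ]; exact integral_nonneg fun v => mul_self_nonneg _
  · rw [hβ, integral_eq_zero_iff_of_nonneg (fun v => mul_self_nonneg _) (hint x x)] at hx
    by_contra hx0
    -- The integrand is continuous, so vanishing almost everywhere on the ball means vanishing on
    -- all of it, in particular at the multiple of `x` of norm `ε / 2`.
    have h1 : ∀ᵐ v ∂(vol.restrict (Metric.ball (0 : V) ε)), inner ℝ v x * inner ℝ v x = 0 :=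
      ae_restrict_of_ae_restrict_of_subset hball hx
    have h2 : Set.EqOn (fun v : V => inner ℝ v x * inner ℝ v x) (fun _ => (0 : ℝ))
        (Metric.ball (0 : V) ε) :=
      Measure.eqOn_open_of_ae_eq h1 Metric.isOpen_ball (by fun_prop) (by fun_prop)
    have hn : 0 < ‖x‖ := norm_pos_iff.mpr hx0
    have h3 := @h2 ((ε / 2 / ‖x‖) • x) (by
      rw [mem_ball_zero_iff, norm_smul, Real.norm_of_nonneg (by positivity),
        div_mul_cancel₀ _ hn.ne']
      linarith)
    simp only [inner_smul_left, real_inner_self_eq_norm_sq, mul_self_eq_zero] at h3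
    have : (0 : ℝ) < (ε / 2 / ‖x‖) * ‖x‖ ^ 2 := by positivity
    exact this.ne' h3
  -- Integrating the constant 1 shows that the adjoint has determinant ±1, since the polar body has
  -- finite positive volume.
  · have hdet := hcv g hg (fun _ => 1)
    have h1 : ∫ _ in polarBody Ω, (1 : ℝ) ∂vol = vol.real (polarBody Ω) := by simp
    rw [h1] at hdet
    have hd1 : |LinearMap.det (LinearMap.adjoint (g : V →ₗ[ℝ] V))| = 1 := by
      have := mul_right_cancel₀ hpos.ne' ((one_mul _).trans hdet)
      exact this.symm
    rw [hβ, hβ, hcv g hg fun v => inner ℝ v x * inner ℝ v y, hd1, one_mul]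
    simp only [LinearMap.adjoint_inner_left, LinearEquiv.coe_coe]

end

end ConvexBody

/-! ### Invariant points and the representation of the dual cone -/

namespace ConvexBody

variable {V : Type*} [NormedAddCommGroup V] [InnerProductSpace ℝ V]

/-- Some functional with values in `[0, 1]` on `Ω` takes the value `1` at `a` and `0` at `b`. -/
def Separated (Ω : Set V) (a b : V) : Prop :=
  ∃ f : V →ₗ[ℝ] ℝ, (∀ x ∈ Ω, 0 ≤ f x ∧ f x ≤ 1) ∧ f a = 1 ∧ f b = 0

/-- Any two extreme points are related by a linear symmetry of `Ω`. -/
def TransitiveOnExtreme (Ω : Set V) : Prop :=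
  ∀ a ∈ Ω.extremePoints ℝ, ∀ b ∈ Ω.extremePoints ℝ,
    ∃ g : V ≃ₗ[ℝ] V, g '' Ω = Ω ∧ g a = b

/-- Any two pairs of separated extreme points are related by a linear symmetry of `Ω`. -/
def BitSymmetric (Ω : Set V) : Prop :=
  ∀ a ∈ Ω.extremePoints ℝ, ∀ b ∈ Ω.extremePoints ℝ, ∀ a' ∈ Ω.extremePoints ℝ,
    ∀ b' ∈ Ω.extremePoints ℝ, Separated Ω a b → Separated Ω a' b' →
      ∃ g : V ≃ₗ[ℝ] V, g '' Ω = Ω ∧ g a = a' ∧ g b = b'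

/-- A bilinear form that identifies the cone over `Ω` with its dual cone, normalised on the
extreme points. -/
structure IsSelfDualizing (Ω : Set V) (B : V →ₗ[ℝ] V →ₗ[ℝ] ℝ) : Prop where
  symm : ∀ x y, B x y = B y x
  self_eq_one : ∀ a ∈ Ω.extremePoints ℝ, B a a = 1
  nonneg : ∀ x ∈ Ω, ∀ y ∈ Ω, 0 ≤ B x y
  le_one : ∀ x ∈ Ω, ∀ y ∈ Ω, B x y ≤ 1
  eq_of_eq_one : ∀ a ∈ Ω.extremePoints ℝ, ∀ y ∈ Ω, B a y = 1 → y = a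
  eq_zero_of_separated : ∀ a ∈ Ω.extremePoints ℝ, ∀ b ∈ Ω.extremePoints ℝ,
    Separated Ω a b → B a b = 0
  eq_zero : ∀ x, B x = 0 → x = 0
  exists_repr : ∀ f : V →ₗ[ℝ] ℝ, (∀ x ∈ Ω, 0 ≤ f x) →
    ∃ c : ℝ, 0 ≤ c ∧ ∃ x ∈ Ω, f = B (c • x)

theorem image_symm_eq {Ω : Set V} {g : V ≃ₗ[ℝ] V} (hg : g '' Ω = Ω) : g.symm '' Ω = Ω := by
  conv_lhs => rw [← hg]
  rw [← Set.image_comp]; simp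

variable [FiniteDimensional ℝ V]

theorem continuous_quadratic (β : V →ₗ[ℝ] V →ₗ[ℝ] ℝ) : Continuous fun x => β x x := by
  let β' : V →L[ℝ] V →L[ℝ] ℝ := LinearMap.toContinuousLinearMap
    ((LinearMap.toContinuousLinearMap : (V →ₗ[ℝ] ℝ) ≃ₗ[ℝ] (V →L[ℝ] ℝ)).toLinearMap ∘ₗ β)
  have : (fun x => β x x) = fun x => β' x x := rfl
  rw [this]
  fun_prop

/-- A functional vanishing at an interior symmetric point vanishes. -/
theorem eq_zero_of_apply_fixed {Ω : Set V} (hc : IsCompact Ω)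
    (hs : Submodule.span ℝ Ω = ⊤) (htr : TransitiveOnExtreme Ω) {μ : V} (hμ : μ ∈ Ω)
    (hfix : ∀ g : V ≃ₗ[ℝ] V, g '' Ω = Ω → g μ = μ) (f : V →ₗ[ℝ] ℝ) (hf : ∀ x ∈ Ω, 0 ≤ f x)
    (h0 : f μ = 0) : f = 0 := by
  -- `F` is a face containing `μ`, hence contains an extreme point of `Ω`; transitivity spreads the
  -- zero of `f` from there to all extreme points.
  let F : Set V := {x ∈ Ω | ∀ g : V ≃ₗ[ℝ] V, g '' Ω = Ω → f (g x) = 0}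
  have hFΩ : IsExtreme ℝ Ω F := by
    refine ⟨fun x hx => hx.1, ?_⟩
    rintro x hx y hy z hz ⟨a, b, ha, hb, hab, rfl⟩
    refine ⟨hx, fun g hg => ?_⟩
    have h1 := hz.2 g hg
    have h2 := hf (g x) (hg ▸ Set.mem_image_of_mem g hx)
    have h3 := hf (g y) (hg ▸ Set.mem_image_of_mem g hy)
    simp only [map_add, map_smul, smul_eq_mul] at h1
    have h4 : 0 ≤ b * f (g y) := by positivity
    have h5 : 0 ≤ a * f (g x) := by positivity
    have h6 : a * f (g x) = 0 := by linarith
    exact (mul_eq_zero.mp h6).resolve_left ha.ne'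
  have hFc : IsCompact F := by
    have : F = Ω ∩ ⋂ g : {g : V ≃ₗ[ℝ] V // g '' Ω = Ω}, {x | f (g.1 x) = 0} := by
      ext x; simp [F]
    rw [this]
    refine hc.inter_right (isClosed_iInter fun g => isClosed_eq ?_ continuous_const)
    exact continuous_linear (f ∘ₗ (g.1 : V →ₗ[ℝ] V))
  obtain ⟨a, ha⟩ := hFc.extremePoints_nonempty ⟨μ, hμ, fun g hg => by rw [hfix g hg, h0]⟩
  refine eq_of_eq_on_extreme hc hs f 0 fun b hb => ?_
  obtain ⟨g, hg, rfl⟩ := htr a (hFΩ.extremePoints_subset_extremePoints ha) b hb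
  exact ha.1.2 g hg

/-- A compact convex set has a point fixed by all symmetries that preserve a given inner
product. -/
theorem exists_fixed_point {Ω : Set V} (hc : IsCompact Ω) (hcv : Convex ℝ Ω)
    (hne : Ω.Nonempty) (β : V →ₗ[ℝ] V →ₗ[ℝ] ℝ) (hsym : ∀ x y, β x y = β y x)
    (hnn : ∀ x, 0 ≤ β x x) (hdef : ∀ x, β x x = 0 → x = 0)
    (hinv : ∀ g : V ≃ₗ[ℝ] V, g '' Ω = Ω → ∀ x y, β (g x) (g y) = β x y) :
    ∃ μ ∈ Ω, ∀ g : V ≃ₗ[ℝ] V, g '' Ω = Ω → g μ = μ := by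
  obtain ⟨μ, hμ, hmin⟩ := hc.exists_isMinOn hne (continuous_quadratic β).continuousOn
  refine ⟨μ, hμ, fun g hg => ?_⟩
  have hgμ : g μ ∈ Ω := hg ▸ Set.mem_image_of_mem g hμ
  -- `μ` and `g μ` have equal minimal length, so by the parallelogram law a shorter midpoint is
  -- avoided only if they coincide.
  have h1 : β μ μ ≤ β ((1 / 2 : ℝ) • g μ + (1 / 2 : ℝ) • μ)
      ((1 / 2 : ℝ) • g μ + (1 / 2 : ℝ) • μ) :=
    hmin (hcv hgμ hμ (by norm_num) (by norm_num) (by norm_num))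
  have h2 := hinv g hg μ μ
  have h3 := hnn (g μ - μ)
  simp only [map_add, map_smul, LinearMap.add_apply, LinearMap.smul_apply, smul_eq_mul,
    hsym μ (g μ)] at h1
  refine sub_eq_zero.mp (hdef _ (le_antisymm ?_ h3))
  simp only [map_sub, LinearMap.sub_apply, hsym μ (g μ)]
  linarith

/-- **Self-duality from bit symmetry** (Müller–Ududec), the converse inclusion: if separated
extreme points are orthogonal, every nonnegative functional is represented in the cone. -/
theorem exists_repr_of_orthogonal {Ω : Set V} (hc : IsCompact Ω) (hcv : Convex ℝ Ω)
    (u : V →ₗ[ℝ] ℝ) (hu : ∀ x ∈ Ω, u x = 1)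
    (B : V →ₗ[ℝ] V →ₗ[ℝ] ℝ) (hsym : ∀ x y, B x y = B y x)
    (hnn : ∀ x ∈ Ω, ∀ y ∈ Ω, 0 ≤ B x y)
    (horth : ∀ a ∈ Ω.extremePoints ℝ, ∀ b ∈ Ω.extremePoints ℝ, Separated Ω a b → B a b = 0)
    {μ : V} (hμ : μ ∈ Ω) {κ : ℝ} (hκ : 0 < κ) (hBμ : B μ = κ • u)
    (hint : ∀ f : V →ₗ[ℝ] ℝ, (∀ x ∈ Ω, 0 ≤ f x) → f μ = 0 → f = 0)
    (f : V →ₗ[ℝ] ℝ) (hf : ∀ x ∈ Ω, 0 ≤ f x) :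
    ∃ c : ℝ, 0 ≤ c ∧ ∃ x ∈ Ω, f = B (c • x) := by
  have hne : Ω.Nonempty := ⟨μ, hμ⟩
  rcases (hf μ hμ).eq_or_lt with h0 | hfμ
  · exact ⟨0, le_rfl, μ, hμ, by rw [zero_smul, map_zero]; exact hint f hf h0.symm⟩
  have hBx : ∀ x ∈ Ω, B x μ = κ := fun x hx => by
    rw [hsym, hBμ, LinearMap.smul_apply, hu x hx, smul_eq_mul, mul_one]
  have hint' : ∀ y : V, (∀ x ∈ Ω, 0 ≤ inner ℝ y x) → inner ℝ y μ = 0 → y = 0 := by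
    intro y hy h0
    have := hint (innerₗ V y) hy h0
    have := LinearMap.congr_fun this y
    simpa using this
  choose J hJ using fun x => exists_riesz (B x)
  have hJlin : IsLinearMap ℝ J :=
    ⟨fun x y => ext_inner_right ℝ fun z => by
        rw [inner_add_left, ← hJ, ← hJ, ← hJ, map_add, LinearMap.add_apply],
      fun c x => ext_inner_right ℝ fun z => by
        rw [real_inner_smul_left, ← hJ, ← hJ, map_smul, LinearMap.smul_apply, smul_eq_mul]⟩
  obtain ⟨w, hw⟩ := exists_riesz ((κ / f μ) • f)
  by_contra hcon
  have hwP : w ∉ J '' Ω := by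
    rintro ⟨x, hx, rfl⟩
    refine hcon ⟨f μ / κ, by positivity, x, hx, ?_⟩
    ext y
    have := hw y
    rw [← hJ, LinearMap.smul_apply, smul_eq_mul] at this
    rw [map_smul, LinearMap.smul_apply, smul_eq_mul, ← this]
    field_simp
  -- `D` is the section of the dual cone at height `κ` and `J '' Ω` the part of it that is
  -- represented; `w` is the rescaled counterexample in the gap.
  let D : Set V := {y | (∀ x ∈ Ω, 0 ≤ inner ℝ y x) ∧ inner ℝ y μ = κ}
  have hwD : w ∈ D := by
    refine ⟨fun x hx => ?_, ?_⟩
    · rw [← hw, LinearMap.smul_apply, smul_eq_mul]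
      exact mul_nonneg (by positivity) (hf x hx)
    · rw [← hw, LinearMap.smul_apply, smul_eq_mul]
      field_simp
  have hPD : ∀ x ∈ Ω, J x ∈ D := fun x hx =>
    ⟨fun y hy => by rw [← hJ]; exact hnn x hx y hy, by rw [← hJ]; exact hBx x hx⟩
  have hPc : IsCompact (J '' Ω) :=
    hc.image (hJlin.mk' J).continuous_of_finiteDimensional
  have hPcv : Convex ℝ (J '' Ω) := hcv.is_linear_image hJlin
  have hClosed : IsClosed {y : V | ∀ x ∈ Ω, 0 ≤ inner ℝ y x} := by
    have : {y : V | ∀ x ∈ Ω, 0 ≤ inner ℝ y x} = ⋂ x ∈ Ω, {y : V | 0 ≤ inner ℝ y x} := by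
      ext y; simp
    rw [this]
    exact isClosed_biInter fun x _ => isClosed_le continuous_const (by fun_prop)
  have hDc : IsCompact D := by
    refine Metric.isCompact_of_isClosed_isBounded
      (hClosed.inter (isClosed_eq (by fun_prop) continuous_const)) ?_
    have hK : IsCompact ({y : V | ∀ x ∈ Ω, 0 ≤ inner ℝ y x} ∩ Metric.sphere 0 1) :=
      (isCompact_sphere 0 1).inter_left hClosed
    have hscale : ∀ y ∈ D, ‖y‖⁻¹ • y ∈
        {y : V | ∀ x ∈ Ω, 0 ≤ inner ℝ y x} ∩ Metric.sphere 0 1 := by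
      intro y hy
      have hy0 : y ≠ 0 := by
        rintro rfl
        have := hy.2
        simp at this
        exact hκ.ne this
      refine ⟨fun x hx => ?_, ?_⟩
      · rw [real_inner_smul_left]
        exact mul_nonneg (by positivity) (hy.1 x hx)
      · rw [mem_sphere_zero_iff_norm, norm_smul, norm_inv, norm_norm,
          inv_mul_cancel₀ (norm_ne_zero_iff.mpr hy0)]
    -- No nonzero dual vector vanishes at `μ`, so on unit dual vectors the pairing with `μ` has a
    -- positive minimum, and this bounds `D`.
    obtain ⟨y₀, hy₀, hmin⟩ := hK.exists_isMinOn ⟨_, hscale w hwD⟩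
      (f := fun y => inner ℝ y μ) (by fun_prop)
    have hδ : 0 < inner ℝ y₀ μ := by
      refine lt_of_le_of_ne (hy₀.1 μ hμ) fun h => ?_
      have h1 := hint' y₀ hy₀.1 h.symm
      have h2 := hy₀.2
      rw [h1] at h2
      simp at h2
    refine (Metric.isBounded_closedBall (x := (0 : V)) (r := κ / inner ℝ y₀ μ)).subset
      fun y hy => ?_
    rw [mem_closedBall_zero_iff, le_div_iff₀ hδ]
    have h1 : inner ℝ y₀ μ ≤ inner ℝ (‖y‖⁻¹ • y) μ := hmin (hscale y hy)
    rw [real_inner_smul_left, hy.2] at h1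
    rcases (norm_nonneg y).eq_or_lt with h2 | h2
    · rw [← h2]; simpa using hκ.le
    · rwa [inv_mul_eq_div, le_div_iff₀ h2, mul_comm] at h1
  -- a point of the dual section that is exposed and not represented
  obtain ⟨ℓ, s, hℓP, hℓw⟩ := geometric_hahn_banach_closed_point hPcv hPc.isClosed hwP
  obtain ⟨R, hR, hPR⟩ := hPc.isBounded.exists_pos_norm_le
  obtain ⟨l, hl⟩ := exists_riesz (ℓ : V →ₗ[ℝ] ℝ)
  replace hl : ∀ x, ℓ x = inner ℝ l x := hl
  -- `T` is large enough for the advantage of `w` in `ℓ` to outweigh the norm of any point of `J ''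
  -- Ω`, so the maximizer below is not represented.
  obtain ⟨T, hT, hTR⟩ : ∃ T : ℝ, 0 < T ∧ 2 * T * (ℓ w - s) = R ^ 2 := by
    have : 0 < ℓ w - s := by linarith
    exact ⟨R ^ 2 / (2 * (ℓ w - s)), by positivity, by field_simp⟩
  -- Up to a constant the objective is `‖y + T • l‖ ^ 2`. The point `q` of `D` farthest from `-T •
  -- l` is exposed with a quadratic margin, with normal `n`.
  obtain ⟨q, hqD, hqmax⟩ := hDc.exists_isMaxOn ⟨w, hwD⟩
    (f := fun y => ‖y‖ ^ 2 + 2 * T * ℓ y) (by fun_prop)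
  have hqP : q ∉ J '' Ω := by
    intro hq
    have h1 : ‖w‖ ^ 2 + 2 * T * ℓ w ≤ ‖q‖ ^ 2 + 2 * T * ℓ q := hqmax hwD
    have h2 := hℓP q hq
    have h3 : ‖q‖ ^ 2 ≤ R ^ 2 := by
      have := hPR q hq
      gcongr
    have h4 : T * ℓ q < T * s := by gcongr
    nlinarith [sq_nonneg ‖w‖]
  let n : V := q + T • l
  have hn : ∀ y ∈ D, ‖y - q‖ ^ 2 ≤ 2 * (inner ℝ n q - inner ℝ n y) := by
    intro y hy
    have h1 : ‖y‖ ^ 2 + 2 * T * ℓ y ≤ ‖q‖ ^ 2 + 2 * T * ℓ q := hqmax hy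
    have h2 := norm_sub_sq_real y q
    simp only [n, inner_add_left, real_inner_smul_left, ← hl, real_inner_self_eq_norm_sq]
    rw [real_inner_comm] at h2
    linarith
  -- The supporting hyperplane of `D` at `q`, made homogeneous: `m` pairs to zero with `q` and
  -- positively with every other point of `D`. It therefore lies in the cone over `Ω`.
  let m : V := (inner ℝ n q / κ) • μ - n
  have hmy : ∀ y ∈ D, inner ℝ y m = inner ℝ n q - inner ℝ n y := by
    intro y hy
    simp only [m, inner_sub_right, real_inner_smul_right, hy.2, real_inner_comm y n]
    field_simp
  obtain ⟨c, hc0, x₀, hx₀, hmx⟩ := mem_cone_of_forall_nonneg hc hcv hne u hu m (by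
    intro φ hφ
    obtain ⟨y, hy⟩ := exists_riesz φ
    rw [hy]
    simp only [hy] at hφ
    rcases (hφ μ hμ).eq_or_lt with h0 | hpos
    · rw [hint' y hφ h0.symm, inner_zero_left]
    · have hyD : (κ / inner ℝ y μ) • y ∈ D := by
        refine ⟨fun x hx => ?_, ?_⟩
        · rw [real_inner_smul_left]
          exact mul_nonneg (by positivity) (hφ x hx)
        · rw [real_inner_smul_left]
          field_simp
      have h1 := hn _ hyD
      rw [← hmy _ hyD, real_inner_smul_left] at h1
      have h2 : 0 ≤ κ / inner ℝ y μ * inner ℝ y m := by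
        nlinarith [sq_nonneg ‖(κ / inner ℝ y μ) • y - q‖]
      exact nonneg_of_mul_nonneg_right h2 (by positivity))
  obtain ⟨a, ha, hamax⟩ := exists_extreme_maximizer hc hne (innerₗ V q)
  simp only [innerₗ_apply_apply] at hamax
  have hqa : 0 < inner ℝ q a := lt_of_lt_of_le hκ (hqD.2 ▸ hamax μ hμ)
  have hJam : 0 < B a m := by
    have h1 := hn _ (hPD a ha.1)
    rw [← hmy _ (hPD a ha.1), ← hJ] at h1
    have h2 : J a - q ≠ 0 := fun h => hqP ⟨a, ha.1, sub_eq_zero.mp h⟩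
    have h3 : 0 < ‖J a - q‖ ^ 2 := by positivity
    linarith
  rw [hmx, map_smul, smul_eq_mul] at hJam
  have hcpos : 0 < c := lt_of_le_of_ne hc0 fun h => by
    rw [← h, zero_mul] at hJam; exact lt_irrefl _ hJam
  have hBx₀ : 0 < B a x₀ := pos_of_mul_pos_right hJam hc0
  have hqx₀ : inner ℝ q x₀ = 0 := by
    have h1 := hmy q hqD
    rw [hmx, real_inner_smul_right, sub_self] at h1
    exact (mul_eq_zero.mp h1).resolve_left hcpos.ne'
  -- The scaled functional `q` separates `a` from every extreme point `z` of its zero face, forcing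
  -- `B a z = 0`. But `x₀` lies in that face and `B a x₀ > 0`.
  have hZc : IsCompact {x ∈ Ω | inner ℝ q x = 0} :=
    hc.inter_right (isClosed_eq (by fun_prop) continuous_const)
  obtain ⟨z, hz, hzmax⟩ := exists_extreme_maximizer hZc ⟨x₀, hx₀, hqx₀⟩ (B a)
  have hZ : {x ∈ Ω | inner ℝ q x = 0} =
      {x ∈ Ω | ∀ y ∈ Ω, innerₗ V q x ≤ innerₗ V q y} := by
    ext x
    simp only [innerₗ_apply_apply, Set.mem_ofPred_eq]
    refine and_congr_right fun hx => ⟨fun h y hy => h ▸ hqD.1 y hy, fun h => ?_⟩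
    exact le_antisymm (hqx₀ ▸ h x₀ hx₀) (hqD.1 x hx)
  have hzΩ : z ∈ Ω.extremePoints ℝ := by
    rw [hZ] at hz
    exact (isExtreme_minimizers Ω (innerₗ V q)).extremePoints_subset_extremePoints hz
  have hsep : Separated Ω a z := by
    refine ⟨(inner ℝ q a)⁻¹ • innerₗ V q, fun x hx => ?_, ?_, ?_⟩
    · simp only [LinearMap.smul_apply, innerₗ_apply_apply, smul_eq_mul]
      refine ⟨mul_nonneg (by positivity) (hqD.1 x hx), ?_⟩
      rw [inv_mul_le_iff₀ hqa, mul_one]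
      exact hamax x hx
    · simp [hqa.ne']
    · have := hz.1.2
      simp [this]
  have := hzmax x₀ ⟨hx₀, hqx₀⟩
  rw [horth a ha z hzΩ hsep] at this
  linarith

end ConvexBody

/-! ### The self-dualizing form and decompositions of the unit -/

namespace ConvexBody

variable {V : Type*} [NormedAddCommGroup V] [InnerProductSpace ℝ V]

/-- **Bit symmetry implies self-duality** (Müller–Ududec). -/
theorem exists_isSelfDualizing [FiniteDimensional ℝ V] {Ω : Set V} (hc : IsCompact Ω) (hcv : Convex ℝ Ω)
    (hs : Submodule.span ℝ Ω = ⊤) (u : V →ₗ[ℝ] ℝ) (hu : ∀ x ∈ Ω, u x = 1)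
    (hnt : Ω.Nontrivial) (htr : TransitiveOnExtreme Ω) (hbit : BitSymmetric Ω) :
    ∃ B : V →ₗ[ℝ] V →ₗ[ℝ] ℝ, IsSelfDualizing Ω B := by
  have hne := hnt.nonempty
  obtain ⟨β, hsym, hnn, hdef, hinv⟩ := exists_invariant_form hc hs
  obtain ⟨μ, hμ, hfix⟩ := exists_fixed_point hc hcv hne β hsym hnn hdef hinv
  obtain ⟨a, ha⟩ := hc.extremePoints_nonempty hne
  obtain ⟨b, hb, hbmin⟩ := exists_extreme_minimizer hc hne (β a)
  have hint := fun f => eq_zero_of_apply_fixed hc hs htr hμ hfix f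
  -- Invariance of `β` and of `μ` makes `β μ` constant on extreme points.
  have hβμ : β μ = β μ a • u := by
    refine eq_of_eq_on_extreme hc hs _ _ fun a' ha' => ?_
    obtain ⟨g, hg, rfl⟩ := htr a ha a' ha'
    rw [LinearMap.smul_apply, hu _ ha'.1, smul_eq_mul, mul_one]
    conv_lhs => rw [← hfix g hg]
    exact hinv g hg μ a
  have hr : ∀ a' ∈ Ω.extremePoints ℝ, β a' a' = β a a := by
    intro a' ha'
    obtain ⟨g, hg, rfl⟩ := htr a ha a' ha'
    exact hinv g hg a a
  have hcl : ∀ x ∈ Ω, ∀ y ∈ Ω, β a b ≤ β x y := by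
    have h1 : ∀ a' ∈ Ω.extremePoints ℝ, ∀ y ∈ Ω, β a b ≤ β a' y := by
      intro a' ha' y hy
      obtain ⟨g, hg, rfl⟩ := htr a ha a' ha'
      have h2 : g.symm y ∈ Ω := image_symm_eq hg ▸ Set.mem_image_of_mem g.symm hy
      have h3 := hbmin _ h2
      have h4 := hinv g hg a (g.symm y)
      rw [LinearEquiv.apply_symm_apply] at h4
      rwa [h4]
    intro x hx y hy
    have := le_of_le_on_extreme hc (β a b • u) (β y) (fun a' ha' => by
      rw [LinearMap.smul_apply, hu _ ha'.1, smul_eq_mul, mul_one, hsym y]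
      exact h1 a' ha' y hy) x hx
    rwa [LinearMap.smul_apply, hu _ hx, smul_eq_mul, mul_one, hsym y] at this
  have hru : ∀ x ∈ Ω, ∀ y ∈ Ω, β x y ≤ β a a := by
    have h1 : ∀ a' ∈ Ω.extremePoints ℝ, ∀ b' ∈ Ω.extremePoints ℝ, β a' b' ≤ β a a := by
      intro a' ha' b' hb'
      have := hnn (a' - b')
      simp only [map_sub, LinearMap.sub_apply, hr a' ha', hr b' hb', hsym b' a'] at this
      linarith
    have h2 : ∀ a' ∈ Ω.extremePoints ℝ, ∀ y ∈ Ω, β a' y ≤ β a a := by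
      intro a' ha' y hy
      have := le_of_le_on_extreme hc (β a') (β a a • u) (fun b' hb' => by
        rw [LinearMap.smul_apply, hu _ hb'.1, smul_eq_mul, mul_one]
        exact h1 a' ha' b' hb') y hy
      rwa [LinearMap.smul_apply, hu _ hy, smul_eq_mul, mul_one] at this
    intro x hx y hy
    have := le_of_le_on_extreme hc (β y) (β a a • u) (fun a' ha' => by
      rw [LinearMap.smul_apply, hu _ ha'.1, smul_eq_mul, mul_one, hsym]
      exact h2 a' ha' y hy) x hx
    rwa [LinearMap.smul_apply, hu _ hx, smul_eq_mul, mul_one, hsym] at this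
  have heq : ∀ a' ∈ Ω.extremePoints ℝ, ∀ y ∈ Ω, β a' y = β a a → y = a' := by
    intro a' ha' y hy h
    refine sub_eq_zero.mp (hdef _ (le_antisymm ?_ (hnn _)))
    have h1 := hru y hy y hy
    simp only [map_sub, LinearMap.sub_apply, hr a' ha', hsym y a', h]
    linarith
  have hlt : β a b < β a a := by
    refine lt_of_le_of_ne (hru a ha.1 b hb.1) fun h => ?_
    have h1 : ∀ x ∈ Ω, x = a := fun x hx =>
      heq a ha x hx (le_antisymm (hru a ha.1 x hx) (h ▸ hbmin x hx))
    obtain ⟨x, hx, y, hy, hxy⟩ := hnt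
    exact hxy ((h1 x hx).trans (h1 y hy).symm)
  have hd : 0 < β a a - β a b := sub_pos.mpr hlt
  -- On `Ω` this rescales `β` affinely so that its minimum `β a b` becomes 0 and its maximum `β a a`
  -- becomes 1.
  let B : V →ₗ[ℝ] V →ₗ[ℝ] ℝ := (β a a - β a b)⁻¹ • (β - β a b • u.smulRight u)
  have hB : ∀ x y, B x y = (β a a - β a b)⁻¹ * (β x y - β a b * (u x * u y)) := by
    intro x y; simp [B]
  have hBΩ : ∀ x ∈ Ω, ∀ y ∈ Ω, B x y = (β a a - β a b)⁻¹ * (β x y - β a b) := by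
    intro x hx y hy
    rw [hB, hu x hx, hu y hy, mul_one, mul_one]
  have hBsym : ∀ x y, B x y = B y x := fun x y => by rw [hB, hB, hsym x, mul_comm (u x)]
  have hBnn : ∀ x ∈ Ω, ∀ y ∈ Ω, 0 ≤ B x y := by
    intro x hx y hy
    rw [hBΩ x hx y hy]
    exact mul_nonneg (by positivity) (sub_nonneg.mpr (hcl x hx y hy))
  have hBself : ∀ a' ∈ Ω.extremePoints ℝ, B a' a' = 1 := by
    intro a' ha'
    rw [hBΩ a' ha'.1 a' ha'.1, hr a' ha']
    exact inv_mul_cancel₀ hd.ne'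
  have hBle : ∀ x ∈ Ω, ∀ y ∈ Ω, B x y ≤ 1 := by
    intro x hx y hy
    rw [hBΩ x hx y hy, inv_mul_le_iff₀ hd, mul_one]
    linarith [hru x hx y hy]
  have hBsep : ∀ a' ∈ Ω.extremePoints ℝ, ∀ b' ∈ Ω.extremePoints ℝ,
      Separated Ω a' b' → B a' b' = 0 := by
    intro a' ha' b' hb' hsep
    -- The minimizing pair is itself separated, by `B a`; bit symmetry carries its value 0 to every
    -- separated pair.
    have h0 : Separated Ω a b := by
      refine ⟨B a, fun x hx => ⟨hBnn a ha.1 x hx, hBle a ha.1 x hx⟩, hBself a ha, ?_⟩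
      rw [hBΩ a ha.1 b hb.1, sub_self, mul_zero]
    obtain ⟨g, hg, rfl, rfl⟩ := hbit a ha b hb a' ha' b' hb' h0 hsep
    rw [hBΩ _ ha'.1 _ hb'.1, hinv g hg, sub_self, mul_zero]
  have hBμ : B μ = ((β a a - β a b)⁻¹ * (β μ a - β a b)) • u := by
    ext y
    rw [hB, hβμ, hu μ hμ]
    simp [hu a ha.1]; ring
  have hκ : 0 < (β a a - β a b)⁻¹ * (β μ a - β a b) := by
    rw [← hBΩ μ hμ a ha.1, hBsym]
    refine lt_of_le_of_ne (hBnn a ha.1 μ hμ) fun h => ?_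
    have := hint (B a) (hBnn a ha.1) h.symm
    have h1 := hBself a ha
    rw [this] at h1
    simp at h1
  refine ⟨B, hBsym, hBself, hBnn, hBle, fun a' ha' y hy h => ?_, hBsep, fun x hx => ?_,
    exists_repr_of_orthogonal hc hcv u hu B hBsym hBnn hBsep hμ hκ hBμ hint⟩
  · rw [hBΩ a' ha'.1 y hy, inv_mul_eq_iff_eq_mul₀ hd.ne'] at h
    exact heq a' ha' y hy (by linarith)
  · have h1 : B μ x = 0 := by rw [hBsym, hx, LinearMap.zero_apply]
    rw [hBμ, LinearMap.smul_apply, smul_eq_mul] at h1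
    have h2 := (mul_eq_zero.mp h1).resolve_left hκ.ne'
    have h3 : B x x = 0 := by rw [hx, LinearMap.zero_apply]
    rw [hB, h2] at h3
    refine hdef x ?_
    have := (mul_eq_zero.mp h3).resolve_left (inv_pos.mpr hd).ne'
    linarith

/-- Sharp effects can be composed: every functional `f` has a version dominated by `1 - c`
that agrees with `f` where `c` vanishes. -/
def HasCompressions (Ω : Set V) (u : V →ₗ[ℝ] ℝ) : Prop :=
  ∀ c f : V →ₗ[ℝ] ℝ, (∀ x ∈ Ω, 0 ≤ c x ∧ c x ≤ 1) → (∀ x ∈ Ω, 0 ≤ f x ∧ f x ≤ 1) →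
    ∃ g : V →ₗ[ℝ] ℝ, (∀ x ∈ Ω, 0 ≤ g x ∧ g x ≤ (u - c) x) ∧ ∀ x ∈ Ω, c x = 0 → g x = f x

namespace IsSelfDualizing

variable {Ω : Set V} {B : V →ₗ[ℝ] V →ₗ[ℝ] ℝ}

theorem mem_cone (h : IsSelfDualizing Ω B) (z : V) (hz : ∀ x ∈ Ω, 0 ≤ B z x) :
    ∃ c : ℝ, 0 ≤ c ∧ ∃ x ∈ Ω, z = c • x := by
  obtain ⟨c, hc, x, hx, he⟩ := h.exists_repr (B z) hz
  refine ⟨c, hc, x, hx, sub_eq_zero.mp (h.eq_zero _ ?_)⟩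
  rw [map_sub, he, sub_self]

/-- A nonnegative functional with total weight one that is one at `a` is `B a`. -/
theorem eq_of_apply_eq_one (h : IsSelfDualizing Ω B) {u : V →ₗ[ℝ] ℝ} (hu : ∀ x ∈ Ω, u x = 1)
    {y : V} (hy : B y = u) {a : V} (ha : a ∈ Ω.extremePoints ℝ) (f : V →ₗ[ℝ] ℝ)
    (hf : ∀ x ∈ Ω, 0 ≤ f x) (hfy : f y = 1) (hfa : f a = 1) : f = B a := by
  obtain ⟨c, hc, x, hx, rfl⟩ := h.exists_repr f hf
  rw [map_smul, LinearMap.smul_apply, h.symm, hy, hu x hx, smul_eq_mul, mul_one] at hfy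
  subst hfy
  rw [one_smul, h.symm] at hfa
  rw [one_smul, h.eq_of_eq_one a ha x hx hfa]

theorem apply_unit (h : IsSelfDualizing Ω B) {u : V →ₗ[ℝ] ℝ} (hu : ∀ x ∈ Ω, u x = 1)
    {y : V} (hy : B y = u) {x : V} (hx : x ∈ Ω) : B x y = 1 := by
  rw [h.symm, hy, hu x hx]

/-- Mutually orthogonal extreme points can be completed to a decomposition of the unit. -/
theorem sub_sum_nonneg (h : IsSelfDualizing Ω B) {u : V →ₗ[ℝ] ℝ} (hu : ∀ x ∈ Ω, u x = 1)
    (hcomp : HasCompressions Ω u) {y : V} (hy : B y = u) {ι : Type*} [DecidableEq ι]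
    (α : ι → V) (hα : ∀ i, α i ∈ Ω.extremePoints ℝ)
    (hort : ∀ i j, i ≠ j → B (α i) (α j) = 0) (s : Finset ι) :
    ∀ x ∈ Ω, 0 ≤ B (y - ∑ i ∈ s, α i) x := by
  induction s using Finset.induction_on with
  | empty => intro x hx; simp [hy, hu x hx]
  | insert j s hj ih =>
    have hsum : ∀ x, B (∑ i ∈ s, α i) x = ∑ i ∈ s, B (α i) x := fun x => by
      rw [map_sum, LinearMap.sum_apply]
    have hcx : ∀ x ∈ Ω, B (y - ∑ i ∈ s, α i) x = 1 - B (∑ i ∈ s, α i) x := fun x hx => by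
      rw [map_sub, LinearMap.sub_apply, hy, hu x hx]
    -- The compressed version `g` of `B (α j)` turns out to equal `B (α j)`: it has value 1 at `α j`
    -- and total weight 1 on `y`. Its bound by `u - c` is then the next inequality.
    obtain ⟨g, hg, hgf⟩ := hcomp (B (∑ i ∈ s, α i)) (B (α j))
      (fun x hx => ⟨by
        rw [hsum]
        exact Finset.sum_nonneg fun i _ => h.nonneg _ (hα i).1 _ hx, by
        have := ih x hx
        rw [hcx x hx] at this
        linarith⟩)
      (fun x hx => ⟨h.nonneg _ (hα j).1 _ hx, h.le_one _ (hα j).1 _ hx⟩)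
    have hself : ∀ k ∈ s, B (∑ i ∈ s, α i) (α k) = 1 := by
      intro k hk
      rw [hsum, Finset.sum_eq_single_of_mem k hk fun i _ hik => hort i k hik,
        h.self_eq_one _ (hα k)]
    have hgk : ∀ k ∈ s, g (α k) = 0 := by
      intro k hk
      have := hg _ (hα k).1
      rw [LinearMap.sub_apply, hu _ (hα k).1, hself k hk, sub_self] at this
      exact le_antisymm this.2 this.1
    have hjs : B (∑ i ∈ s, α i) (α j) = 0 := by
      rw [hsum]
      exact Finset.sum_eq_zero fun i hi => hort i j fun hij => hj (hij ▸ hi)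
    obtain ⟨t, ht, x₀, hx₀, hrem⟩ := h.mem_cone _ ih
    have hfrem : B (α j) (y - ∑ i ∈ s, α i) = 1 := by
      rw [map_sub, h.apply_unit hu hy (hα j).1, h.symm, hjs, sub_zero]
    have hcrem : B (∑ i ∈ s, α i) (y - ∑ i ∈ s, α i) = 0 := by
      rw [map_sub, map_sum (B (∑ i ∈ s, α i)), Finset.sum_congr rfl hself, hsum,
        Finset.sum_congr rfl fun i _ => h.apply_unit hu hy (hα i).1, sub_self]
    -- The remainder is a multiple of a state on which `B (∑ i ∈ s, α i)` vanishes, where `g` and `B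
    -- (α j)` agree.
    have hgrem : g (y - ∑ i ∈ s, α i) = 1 := by
      rw [hrem, map_smul, smul_eq_mul] at hfrem hcrem ⊢
      have ht0 : t ≠ 0 := fun h0 => by rw [h0, zero_mul] at hfrem; exact zero_ne_one hfrem
      rw [hgf x₀ hx₀ ((mul_eq_zero.mp hcrem).resolve_left ht0), hfrem]
    have hgy : g y = 1 := by
      rwa [map_sub, map_sum, Finset.sum_eq_zero hgk, sub_zero] at hgrem
    have hgB := h.eq_of_apply_eq_one hu hy (hα j) g (fun x hx => (hg x hx).1) hgy (by
      rw [hgf _ (hα j).1 hjs, h.self_eq_one _ (hα j)])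
    intro x hx
    rw [Finset.sum_insert hj, ← sub_sub, sub_right_comm, map_sub, LinearMap.sub_apply,
      hcx x hx, ← hgB]
    have := (hg x hx).2
    rw [LinearMap.sub_apply, hu x hx] at this
    linarith

end IsSelfDualizing

end ConvexBody

/-! ### Tests, causality and classical control -/

namespace OperationalTheory

variable {𝒞 : Type u} [Category.{v} 𝒞] [MonoidalCategory 𝒞] [SymmetricCategory 𝒞]
  [OperationalTheory 𝒞]

theorem IsTest.reindex {A B : 𝒞} {ι κ : Type} [Finite ι] [Finite κ] {f : ι → (A ⟶ B)}
    (hf : IsTest f) (e : κ ≃ ι) : IsTest (f ∘ e) := by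
  classical
  have := Fintype.ofFinite ι
  obtain ⟨g, hg, hgf⟩ := exists_coarse f e.symm e.symm.surjective hf
  have : g = f ∘ e := by
    funext k
    refine eq_of_prob_eq _ _ fun E ρ t => ?_
    rw [hgf k, Finset.sum_eq_single_of_mem (e k) (by simp)]
    · rfl
    · intro i hi hik
      simp only [Finset.mem_filter, Finset.mem_univ, true_and] at hi
      exact absurd (by rw [← hi, Equiv.apply_symm_apply]) hik
  rwa [← this]

theorem IsTest.comp_right {A B D : 𝒞} {ι : Type} [Finite ι] {f : ι → (A ⟶ B)}
    (hf : IsTest f) {g : B ⟶ D} (hg : IsDeterministic g) : IsTest (fun i => f i ≫ g) :=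
  (isTest_comp f _ hf hg).reindex (Equiv.prodPUnit ι).symm

theorem IsTest.comp_left {A B D : 𝒞} {ι : Type} [Finite ι] {f : ι → (B ⟶ D)}
    (hf : IsTest f) {g : A ⟶ B} (hg : IsDeterministic g) : IsTest (fun i => g ≫ f i) :=
  (isTest_comp _ f hg hf).reindex (Equiv.punitProd ι).symm

theorem IsDeterministic.comp {A B D : 𝒞} {f : A ⟶ B} {g : B ⟶ D} (hf : IsDeterministic f)
    (hg : IsDeterministic g) : IsDeterministic (f ≫ g) :=
  IsTest.comp_right hf hg

theorem IsDeterministic.id (A : 𝒞) : IsDeterministic (𝟙 A) := isTest_id A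

theorem IsDeterministic.tensor {A B A' B' : 𝒞} {f : A ⟶ B} {g : A' ⟶ B'}
    (hf : IsDeterministic f) (hg : IsDeterministic g) : IsDeterministic (f ⊗ₘ g) :=
  (isTest_tensor _ _ hf hg).reindex (Equiv.punitProd Unit).symm

theorem IsDeterministic.whiskerLeft (X : 𝒞) {A B : 𝒞} {f : A ⟶ B} (hf : IsDeterministic f) :
    IsDeterministic (X ◁ f) := by
  rw [← id_tensorHom]; exact (IsDeterministic.id X).tensor hf

theorem IsDeterministic.whiskerRight {A B : 𝒞} {f : A ⟶ B} (hf : IsDeterministic f) (X : 𝒞) :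
    IsDeterministic (f ▷ X) := by
  rw [← tensorHom_id]; exact hf.tensor (IsDeterministic.id X)

omit [SymmetricCategory 𝒞] [OperationalTheory 𝒞] in
-- Lets an ancilla be prepared after a state, so that states can be compared by effects alone.
theorem comp_whiskerRight_eq {A E : 𝒞} (r : 𝟙_ 𝒞 ⟶ 𝟙_ 𝒞 ⊗ E) (f : 𝟙_ 𝒞 ⟶ A) :
    r ≫ f ▷ E = f ≫ (ρ_ A).inv ≫ A ◁ (r ≫ (λ_ E).hom) := by
  have h1 : r = (λ_ _).inv ≫ (𝟙_ 𝒞) ◁ (r ≫ (λ_ E).hom) ≫ 𝟙 _ := by simp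
  have h2 : f ≫ (ρ_ A).inv = (λ_ (𝟙_ 𝒞)).inv ≫ f ▷ 𝟙_ 𝒞 := by
    rw [rightUnitor_inv_naturality, unitors_inv_equal]
  conv_lhs => rw [h1]
  rw [Category.comp_id, Category.assoc, whisker_exchange, reassoc_of% h2]

theorem state_ext {A : 𝒞} {f g : 𝟙_ 𝒞 ⟶ A}
    (h : ∀ e : A ⟶ 𝟙_ 𝒞, prob (f ≫ e) = prob (g ≫ e)) : f = g := by
  refine eq_of_prob_eq f g fun E r e => ?_
  have key := fun k : 𝟙_ 𝒞 ⟶ A => congrArg (· ≫ e) (comp_whiskerRight_eq r k)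
  simp only [Category.assoc] at key
  rw [key f, key g]
  exact h _

theorem effect_ext {A : 𝒞} {f g : A ⟶ 𝟙_ 𝒞}
    (h : ∀ r : 𝟙_ 𝒞 ⟶ A, prob (r ≫ f) = prob (r ≫ g)) : f = g := by
  refine eq_of_prob_eq f g fun E r e => ?_
  have key : ∀ k : A ⟶ 𝟙_ 𝒞, k ▷ E ≫ e = (A ◁ ((λ_ E).inv ≫ e) ≫ (ρ_ A).hom) ≫ k := by
    intro k
    have h1 : e = 𝟙_ 𝒞 ◁ ((λ_ E).inv ≫ e) ≫ (λ_ _).hom := by simp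
    conv_lhs => rw [h1]
    rw [← whisker_exchange_assoc, unitors_equal, rightUnitor_naturality, Category.assoc]
  rw [key f, key g]
  simpa only [Category.assoc] using h (r ≫ A ◁ ((λ_ E).inv ≫ e) ≫ (ρ_ A).hom)

theorem hom_ext_of_states {A B : 𝒞} {f g : A ⟶ B}
    (h : ∀ (E : 𝒞) (r : 𝟙_ 𝒞 ⟶ A ⊗ E), r ≫ f ▷ E = r ≫ g ▷ E) : f = g := by
  refine eq_of_prob_eq f g fun E r e => ?_
  rw [← Category.assoc, h, Category.assoc]

theorem scalar_ext {p q : 𝟙_ 𝒞 ⟶ 𝟙_ 𝒞} (h : prob p = prob q) : p = q :=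
  state_ext fun e => by rw [prob_comp, prob_comp, h]

theorem IsSum.prob_comp {A B : 𝒞} {ι : Type} [Fintype ι] {f : ι → (A ⟶ B)} {g : A ⟶ B}
    (h : IsSum f g) (r : 𝟙_ 𝒞 ⟶ A) (e : B ⟶ 𝟙_ 𝒞) :
    prob (r ≫ g ≫ e) = ∑ i, prob (r ≫ f i ≫ e) := by
  simpa using h (𝟙_ 𝒞) (r ≫ (ρ_ A).inv) ((ρ_ B).hom ≫ e)

theorem IsSum.prob_state {B : 𝒞} {ι : Type} [Fintype ι] {f : ι → (𝟙_ 𝒞 ⟶ B)} {g : 𝟙_ 𝒞 ⟶ B}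
    (h : IsSum f g) (e : B ⟶ 𝟙_ 𝒞) :
    prob (g ≫ e) = ∑ i, prob (f i ≫ e) := by
  simpa using h.prob_comp (𝟙 _) e

/-- For preparations it suffices to compare the probabilities of effects. -/
theorem isSum_of_prob_state {B : 𝒞} {ι : Type} [Fintype ι] {f : ι → (𝟙_ 𝒞 ⟶ B)}
    {g : 𝟙_ 𝒞 ⟶ B} (h : ∀ e : B ⟶ 𝟙_ 𝒞, prob (g ≫ e) = ∑ i, prob (f i ≫ e)) : IsSum f g := by
  intro E r e
  have key := fun k : 𝟙_ 𝒞 ⟶ B => congrArg (· ≫ e) (comp_whiskerRight_eq r k)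
  simp only [Category.assoc] at key
  rw [key g, h]
  exact Finset.sum_congr rfl fun i _ => by rw [key]

theorem exists_total {A B : 𝒞} {ι : Type} [Fintype ι] [Nonempty ι] {f : ι → (A ⟶ B)}
    (hf : IsTest f) : ∃ g : A ⟶ B, IsDeterministic g ∧ IsSum f g := by
  obtain ⟨g, hg, hgf⟩ := exists_coarse f (fun _ => ()) (fun _ => ⟨Classical.arbitrary ι, rfl⟩) hf
  exact ⟨g (), hg, fun E r e => by simpa using hgf () E r e⟩

theorem exists_state_of_hom {A : 𝒞} (r : 𝟙_ 𝒞 ⟶ A) : ∃ s : 𝟙_ 𝒞 ⟶ A, IsState s := by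
  obtain ⟨n, t, k, ht, -⟩ := exists_isTest r
  have : Nonempty (Fin n) := ⟨k⟩
  obtain ⟨s, hs, -⟩ := exists_total ht
  exact ⟨s, hs⟩

/-- The deterministic effect. -/
noncomputable def discard (hc : Causal 𝒞) (A : 𝒞) : A ⟶ 𝟙_ 𝒞 := (hc A).choose

section Causal

variable (hc : Causal 𝒞)
include hc

theorem discard_isDeterministic (A : 𝒞) : IsDeterministic (discard hc A) :=
  (hc A).choose_spec.1

theorem IsDeterministic.eq_discard {A : 𝒞} {d : A ⟶ 𝟙_ 𝒞} (hd : IsDeterministic d) :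
    d = discard hc A :=
  (hc A).choose_spec.2.1 d hd

theorem IsTest.isSum_discard {A : 𝒞} {ι : Type} [Fintype ι] {e : ι → (A ⟶ 𝟙_ 𝒞)}
    (he : IsTest e) : IsSum e (discard hc A) :=
  (hc A).choose_spec.2.2 ι e he

theorem discard_unit : discard hc (𝟙_ 𝒞) = 𝟙 _ :=
  ((IsDeterministic.id _).eq_discard hc).symm

theorem IsDeterministic.comp_discard {A B : 𝒞} {f : A ⟶ B} (hf : IsDeterministic f) :
    f ≫ discard hc B = discard hc A :=
  (hf.comp (discard_isDeterministic hc B)).eq_discard hc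

theorem prob_comp_le {A : 𝒞} (r : 𝟙_ 𝒞 ⟶ A) (e : A ⟶ 𝟙_ 𝒞) :
    prob (r ≫ e) ≤ prob (r ≫ discard hc A) := by
  obtain ⟨n, t, k, ht, rfl⟩ := exists_isTest e
  have := (ht.isSum_discard hc).prob_comp r (𝟙 _)
  simp only [Category.comp_id] at this
  rw [this]
  exact Finset.single_le_sum (f := fun i => prob (r ≫ t i)) (fun i _ => prob_nonneg _)
    (Finset.mem_univ k)

/-- No process raises the total probability; for an isomorphism the inverse gives the opposite
bound. -/
theorem iso_comp_discard {A B : 𝒞} (U : A ≅ B) : U.hom ≫ discard hc B = discard hc A := by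
  refine effect_ext fun r => le_antisymm (prob_comp_le hc r _) ?_
  have := prob_comp_le hc (r ≫ U.hom) (U.inv ≫ discard hc A)
  simpa using this

/-- If one outcome of a test already carries all the probability, the others vanish in every
circuit, so it equals the full coarse-graining. -/
theorem isDeterministic_of_comp_discard {A B : 𝒞} {f : A ⟶ B}
    (h : f ≫ discard hc B = discard hc A) : IsDeterministic f := by
  obtain ⟨n, t, k, ht, rfl⟩ := exists_isTest f
  have : Nonempty (Fin n) := ⟨k⟩
  obtain ⟨g, hg, hgt⟩ := exists_total ht
  have hsum := (ht.comp_right (discard_isDeterministic hc B)).isSum_discard hc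
  suffices t k = g by rwa [this]
  refine eq_of_prob_eq _ _ fun E r e => ?_
  rw [hgt E r e]
  symm
  refine Finset.sum_eq_single_of_mem k (Finset.mem_univ k) fun j _ hjk => ?_
  have h1 := hsum E r (discard hc (𝟙_ 𝒞 ⊗ E))
  rw [← Finset.add_sum_erase _ _ (Finset.mem_univ k)] at h1
  simp only [h] at h1
  have h0 := left_eq_add.mp h1
  rw [Finset.sum_eq_zero_iff_of_nonneg fun i _ => prob_nonneg _] at h0
  have h2 := h0 j
    (Finset.mem_erase.mpr ⟨hjk, Finset.mem_univ j⟩)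
  refine le_antisymm (le_trans ?_ h2.le) (prob_nonneg _)
  have h3 := prob_comp_le hc (r ≫ t j ▷ E) e
  have h4 := ((discard_isDeterministic hc B).whiskerRight E).comp_discard hc
  rw [comp_whiskerRight, Category.assoc, h4, ← Category.assoc]
  simpa using h3

theorem IsDeterministic.of_iso {A B : 𝒞} (U : A ≅ B) : IsDeterministic U.hom :=
  isDeterministic_of_comp_discard hc (iso_comp_discard hc U)

theorem isState_iff {A : 𝒞} (s : 𝟙_ 𝒞 ⟶ A) : IsState s ↔ prob (s ≫ discard hc A) = 1 := by
  constructor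
  · intro h
    rw [IsDeterministic.comp_discard hc h, discard_unit, prob_id]
  · intro h
    refine isDeterministic_of_comp_discard hc (scalar_ext ?_)
    rw [h, discard_unit, prob_id]

theorem IsState.prob_discard {A : 𝒞} {s : 𝟙_ 𝒞 ⟶ A} (h : IsState s) :
    prob (s ≫ discard hc A) = 1 :=
  (isState_iff hc s).mp h

theorem IsState.prob_le_one {A : 𝒞} {s : 𝟙_ 𝒞 ⟶ A} (h : IsState s) (e : A ⟶ 𝟙_ 𝒞) :
    prob (s ≫ e) ≤ 1 :=
  (prob_comp_le hc s e).trans (h.prob_discard hc).le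

theorem eq_of_prob_discard_eq_zero {A : 𝒞} {r : 𝟙_ 𝒞 ⟶ A} (h : prob (r ≫ discard hc A) = 0)
    (e : A ⟶ 𝟙_ 𝒞) : prob (r ≫ e) = 0 :=
  le_antisymm ((prob_comp_le hc r e).trans h.le) (prob_nonneg _)

end Causal

/-- Classical control by deterministic processes, followed by forgetting the outcome. -/
theorem exists_controlled_sum (hcontrol : ClassicalControl 𝒞) {A B D : 𝒞} {ι : Type}
    [Fintype ι] [Nonempty ι] {f : ι → (A ⟶ B)} (hf : IsTest f) (g : ι → (B ⟶ D))
    (hg : ∀ i, IsDeterministic (g i)) :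
    IsTest (fun i => f i ≫ g i) ∧ ∃ h : A ⟶ D, IsDeterministic h ∧
      IsSum (fun i => f i ≫ g i) h := by
  have h1 := hcontrol A B D ι (fun _ => Unit) f (fun i _ => g i) hf hg
  have h2 : IsTest (fun i => f i ≫ g i) := h1.reindex (Equiv.sigmaPUnit ι).symm
  exact ⟨h2, exists_total h2⟩

/-- A coin with arbitrary bias is physical. -/
theorem exists_coin (hnores : NoRestriction 𝒞) {p : ℝ} (h0 : 0 ≤ p) (h1 : p ≤ 1) :
    ∃ e : Bool → (𝟙_ 𝒞 ⟶ 𝟙_ 𝒞), IsTest e ∧ prob (e true) = p ∧ prob (e false) = 1 - p := by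
  obtain ⟨e, he, hp⟩ := hnores (𝟙_ 𝒞) Bool
    (fun b => (if b then p else 1 - p) • LinearMap.proj (𝟙 (𝟙_ 𝒞))) (by
      rintro x ⟨s, hs, rfl⟩
      have : prob s = 1 := by
        have := sum_prob _ hs
        simpa using this
      simp [stateVec, this, h0, h1])
  have := hp (𝟙 _) (IsDeterministic.id _)
  refine ⟨e, he, ?_, ?_⟩
  · simpa [stateVec, prob_id] using this true
  · simpa [stateVec, prob_id] using this false

theorem exists_convex_combination (hcontrol : ClassicalControl 𝒞) (hnores : NoRestriction 𝒞)
    {A : 𝒞} {p : ℝ} (h0 : 0 ≤ p) (h1 : p ≤ 1) {σ τ : 𝟙_ 𝒞 ⟶ A} (hσ : IsState σ)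
    (hτ : IsState τ) :
    ∃ r : Bool → (𝟙_ 𝒞 ⟶ A), IsTest r ∧ (∀ e, prob (r true ≫ e) = p * prob (σ ≫ e)) ∧
      (∀ e, prob (r false ≫ e) = (1 - p) * prob (τ ≫ e)) ∧
      ∃ ω, IsState ω ∧ IsSum r ω ∧
        ∀ e, prob (ω ≫ e) = p * prob (σ ≫ e) + (1 - p) * prob (τ ≫ e) := by
  obtain ⟨c, hc, ht, hf⟩ := exists_coin hnores h0 h1
  obtain ⟨hr, ω, hω, hsum⟩ := exists_controlled_sum hcontrol hc
    (fun b => bif b then σ else τ) (by rintro (_ | _) <;> assumption)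
  refine ⟨_, hr, fun e => ?_, fun e => ?_, ω, hω, hsum, fun e => ?_⟩
  · rw [Category.assoc, prob_comp, ht]; rfl
  · rw [Category.assoc, prob_comp, hf]; rfl
  · rw [hsum.prob_state, Fintype.sum_bool]
    simp only [Category.assoc, prob_comp, ht, hf, cond_true, cond_false]

/-- Conditional states are states: repeat a preparation until it succeeds. -/
theorem exists_normalization (hc : Causal 𝒞) (hcontrol : ClassicalControl 𝒞)
    (hclosed : ClosedStates 𝒞) {A : 𝒞} (r : 𝟙_ 𝒞 ⟶ A) (hr : prob (r ≫ discard hc A) ≠ 0) :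
    ∃ σ : 𝟙_ 𝒞 ⟶ A, IsState σ ∧
      ∀ e, prob (r ≫ e) = prob (r ≫ discard hc A) * prob (σ ≫ e) := by
  set c := prob (r ≫ discard hc A) with hcdef
  obtain ⟨n, t, k, ht, htk⟩ := exists_isTest r
  have : Nonempty (Fin n) := ⟨k⟩
  have htot : ∑ i, prob (t i ≫ discard hc A) = 1 :=
    sum_prob _ (ht.comp_right (discard_isDeterministic hc A))
  -- One round: keep the output on outcome `k`, otherwise replace it by `τ`. Iterating leaves weight
  -- `(1 - c) ^ m` on the initial state, and closedness supplies the limit.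
  have hstep : ∀ τ : 𝟙_ 𝒞 ⟶ A, IsState τ → ∃ τ' : 𝟙_ 𝒞 ⟶ A, IsState τ' ∧
      ∀ e, prob (τ' ≫ e) = prob (r ≫ e) + (1 - c) * prob (τ ≫ e) := by
    intro τ hτ
    obtain ⟨-, τ', hτ', hsum⟩ := exists_controlled_sum hcontrol ht
      (fun i => if i = k then 𝟙 A else discard hc A ≫ τ) (by
        intro i
        split_ifs
        · exact IsDeterministic.id A
        · exact (discard_isDeterministic hc A).comp hτ)
    refine ⟨τ', hτ', fun e => ?_⟩
    rw [hsum.prob_state, ← Finset.add_sum_erase _ _ (Finset.mem_univ k)]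
    rw [← Finset.add_sum_erase _ _ (Finset.mem_univ k), htk, ← hcdef] at htot
    have h1 : ∑ i ∈ Finset.univ.erase k,
        prob ((t i ≫ if i = k then 𝟙 A else discard hc A ≫ τ) ≫ e) =
        ∑ i ∈ Finset.univ.erase k, prob (t i ≫ discard hc A) * prob (τ ≫ e) := by
      refine Finset.sum_congr rfl fun i hi => ?_
      rw [if_neg (Finset.ne_of_mem_erase hi), ← prob_comp]
      simp only [Category.assoc]
    rw [h1, ← Finset.sum_mul, if_pos rfl, htk, Category.comp_id, ← htot]
    ring
  obtain ⟨τ₀, hτ₀⟩ := exists_state_of_hom r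
  have hc0 : 0 < c := lt_of_le_of_ne (prob_nonneg _) (Ne.symm hr)
  have hc1 : c ≤ 1 := by
    rw [← htot, hcdef, ← htk]
    exact Finset.single_le_sum (f := fun i => prob (t i ≫ discard hc A))
      (fun i _ => prob_nonneg _) (Finset.mem_univ k)
  have hiter : ∀ m : ℕ, ∃ τ : 𝟙_ 𝒞 ⟶ A, IsState τ ∧
      ∀ e, prob (τ ≫ e) = (1 - (1 - c) ^ m) * (c⁻¹ * prob (r ≫ e)) +
        (1 - c) ^ m * prob (τ₀ ≫ e) := by
    intro m
    induction m with
    | zero => exact ⟨τ₀, hτ₀, fun e => by simp⟩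
    | succ m ih =>
      obtain ⟨τ, hτ, hv⟩ := ih
      obtain ⟨τ', hτ', hv'⟩ := hstep τ hτ
      refine ⟨τ', hτ', fun e => ?_⟩
      rw [hv', hv]
      field_simp
      ring
  choose τ hτ hv using hiter
  have hlim : Filter.Tendsto (fun m => stateVec (τ m)) Filter.atTop
      (nhds fun e => c⁻¹ * prob (r ≫ e)) := by
    rw [tendsto_pi_nhds]
    intro e
    have hpow : Filter.Tendsto (fun m : ℕ => (1 - c) ^ m) Filter.atTop (nhds 0) :=
      tendsto_pow_atTop_nhds_zero_of_lt_one (by linarith) (by linarith)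
    have := ((tendsto_const_nhds (x := (1 : ℝ))).sub hpow).mul_const (c⁻¹ * prob (r ≫ e))
    have := this.add (hpow.mul_const (prob (τ₀ ≫ e)))
    simpa [stateVec, hv] using this
  obtain ⟨σ, hσ, hσv⟩ := (hclosed A).mem_of_tendsto hlim
    (Filter.Eventually.of_forall fun m => ⟨τ m, hτ m, rfl⟩)
  refine ⟨σ, hσ, fun e => ?_⟩
  have := congrFun hσv e
  simp only [stateVec] at this
  rw [← this, mul_inv_cancel_left₀ hr]

end OperationalTheory

/-! ### State spaces as compact convex bodies -/

namespace OperationalTheory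

variable {𝒞 : Type u} [Category.{v} 𝒞] [MonoidalCategory 𝒞] [SymmetricCategory 𝒞]
  [OperationalTheory 𝒞]

/-- The image of the state space under a coordinate map. -/
def stateBody {A : 𝒞} {V : Type*} (v : (𝟙_ 𝒞 ⟶ A) → V) : Set V :=
  {x | ∃ s, IsState s ∧ v s = x}

/-- Linear coordinates on the preparations of a system, in which the state space is a spanning
compact convex set and all well-defined measurements are physical. -/
structure IsCoordinates {A : 𝒞} {V : Type*} [NormedAddCommGroup V] [InnerProductSpace ℝ V]
    (v : (𝟙_ 𝒞 ⟶ A) → V) : Prop where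
  compact : IsCompact (stateBody v)
  convex : Convex ℝ (stateBody v)
  span_eq_top : Submodule.span ℝ (stateBody v) = ⊤
  injective : Function.Injective v
  combination : ∀ (r s t : 𝟙_ 𝒞 ⟶ A) (a b : ℝ),
    (∀ e : A ⟶ 𝟙_ 𝒞, prob (r ≫ e) = a * prob (s ≫ e) + b * prob (t ≫ e)) →
      v r = a • v s + b • v t
  exists_functional : ∀ e : A ⟶ 𝟙_ 𝒞, ∃ f : V →ₗ[ℝ] ℝ, ∀ r, f (v r) = prob (r ≫ e)
  exists_test : ∀ {ι : Type} [Fintype ι] (a : ι → V →ₗ[ℝ] ℝ),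
    (∀ x ∈ stateBody v, (∀ i, 0 ≤ a i x) ∧ ∑ i, a i x = 1) →
      ∃ e : ι → (A ⟶ 𝟙_ 𝒞), IsTest e ∧ ∀ s, IsState s → ∀ i, prob (s ≫ e i) = a i (v s)
  exists_symmetry : ∀ U : A ≅ A, ∃ g : V ≃ₗ[ℝ] V, ∀ r, v (r ≫ U.hom) = g (v r)

theorem isCompact_stateSpace (hc : Causal 𝒞) (hclosed : ClosedStates 𝒞) (A : 𝒞) :
    IsCompact (stateSpace A) := by
  refine IsCompact.of_isClosed_subset
    (isCompact_univ_pi fun _ : (A ⟶ 𝟙_ 𝒞) => isCompact_Icc (a := (0 : ℝ)) (b := 1))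
    (hclosed A) ?_
  rintro _ ⟨s, hs, rfl⟩ e -
  exact ⟨prob_nonneg _, hs.prob_le_one hc e⟩

section

variable (hc : Causal 𝒞) (hcontrol : ClassicalControl 𝒞) (hclosed : ClosedStates 𝒞)
  (hnores : NoRestriction 𝒞) (hfin : FiniteDimensionalStates 𝒞)

include hc hcontrol hclosed in
theorem stateVec_mem_span {A : 𝒞} (r : 𝟙_ 𝒞 ⟶ A) :
    stateVec r ∈ Submodule.span ℝ (stateSpace A) := by
  by_cases h : prob (r ≫ discard hc A) = 0
  · have : stateVec r = 0 := funext fun e => eq_of_prob_discard_eq_zero hc h e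
    rw [this]
    exact Submodule.zero_mem _
  · obtain ⟨σ, hσ, hσr⟩ := exists_normalization hc hcontrol hclosed r h
    have : stateVec r = prob (r ≫ discard hc A) • stateVec σ := funext fun e => hσr e
    rw [this]
    exact Submodule.smul_mem _ _ (Submodule.subset_span ⟨σ, hσ, rfl⟩)

include hc hcontrol hclosed hnores hfin in
theorem exists_coordinates (A : 𝒞) :
    ∃ (d : ℕ) (v : (𝟙_ 𝒞 ⟶ A) → EuclideanSpace ℝ (Fin d)), IsCoordinates v := by
  have := hfin A
  let W := Submodule.span ℝ (stateSpace A)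
  let Φ : W ≃L[ℝ] EuclideanSpace ℝ (Fin (Module.finrank ℝ W)) := toEuclidean
  let ν : (𝟙_ 𝒞 ⟶ A) → W := fun r => ⟨stateVec r, stateVec_mem_span hc hcontrol hclosed r⟩
  have hbody : stateBody (fun r => Φ (ν r)) = Φ '' ((↑) ⁻¹' stateSpace A) := by
    ext x
    constructor
    · rintro ⟨s, hs, rfl⟩
      exact ⟨ν s, ⟨s, hs, rfl⟩, rfl⟩
    · rintro ⟨y, ⟨s, hs, hy⟩, rfl⟩
      exact ⟨s, hs, congrArg Φ (Subtype.ext hy.symm)⟩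
  have hcomb : ∀ (r s t : 𝟙_ 𝒞 ⟶ A) (a b : ℝ),
      (∀ e : A ⟶ 𝟙_ 𝒞, prob (r ≫ e) = a * prob (s ≫ e) + b * prob (t ≫ e)) →
        Φ (ν r) = a • Φ (ν s) + b • Φ (ν t) := by
    intro r s t a b h
    rw [← map_smul, ← map_smul, ← map_add]
    exact congrArg Φ (Subtype.ext (funext h))
  refine ⟨_, fun r => Φ (ν r), ?_, ?_, ?_, ?_, hcomb, ?_, ?_, ?_⟩
  · rw [hbody]
    refine IsCompact.image ?_ Φ.continuous
    rw [Subtype.isCompact_iff, Set.image_preimage_eq_of_subset]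
    · exact isCompact_stateSpace hc hclosed A
    · intro x hx
      exact ⟨⟨x, Submodule.subset_span hx⟩, rfl⟩
  · rintro _ ⟨σ, hσ, rfl⟩ _ ⟨τ, hτ, rfl⟩ a b ha hb hab
    obtain ⟨-, -, -, -, ω, hω, -, h⟩ :=
      exists_convex_combination hcontrol hnores ha (by linarith) hσ hτ
    exact ⟨ω, hω, hcomb _ _ _ _ _ fun e => by rw [h, ← hab]; ring⟩
  · rw [hbody]
    have := Submodule.span_image (s := ((↑) ⁻¹' stateSpace A : Set W))
      (Φ.toLinearEquiv : W →ₗ[ℝ] EuclideanSpace ℝ (Fin (Module.finrank ℝ W)))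
    rw [Submodule.span_span_coe_preimage, Submodule.map_top, LinearEquiv.range] at this
    exact this
  · intro r s hrs
    have h1 := congrArg Subtype.val (Φ.injective hrs)
    exact state_ext fun e => congrFun h1 e
  · intro e
    refine ⟨LinearMap.proj e ∘ₗ W.subtype ∘ₗ (Φ.symm.toLinearEquiv : _ →ₗ[ℝ] W), fun r => ?_⟩
    simp [ν, stateVec]
  · intro ι _ a ha
    choose b hb using fun i =>
      LinearMap.exists_extend
        (a i ∘ₗ (Φ.toLinearEquiv : W →ₗ[ℝ] EuclideanSpace ℝ (Fin (Module.finrank ℝ W))))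
    have hbν : ∀ i r, b i (stateVec r) = a i (Φ (ν r)) := fun i r =>
      LinearMap.congr_fun (hb i) (ν r)
    obtain ⟨e, he, hp⟩ := hnores A ι b (by
      rintro x ⟨s, hs, rfl⟩
      simp only [hbν]
      exact ha _ ⟨s, hs, rfl⟩)
    exact ⟨e, he, fun s hs i => by rw [hp s hs i, hbν]⟩
  · intro U
    let L : (A ≅ A) → (((A ⟶ 𝟙_ 𝒞) → ℝ) →ₗ[ℝ] ((A ⟶ 𝟙_ 𝒞) → ℝ)) := fun U =>
      LinearMap.funLeft ℝ ℝ (fun e => U.hom ≫ e)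
    have hL : ∀ U r, L U (stateVec r) = stateVec (r ≫ U.hom) := by
      intro U r
      funext e
      simp [L, stateVec, LinearMap.funLeft_apply]
    have hLW : ∀ U : A ≅ A, ∀ x ∈ W, L U x ∈ W := by
      intro U
      have : W ≤ W.comap (L U) := by
        refine Submodule.span_le.mpr ?_
        rintro _ ⟨s, hs, rfl⟩
        rw [SetLike.mem_coe, Submodule.mem_comap, hL]
        exact stateVec_mem_span hc hcontrol hclosed _
      exact this
    have hinv : ∀ (U : A ≅ A) (x : W), (L U.symm) ((L U) (x : (A ⟶ 𝟙_ 𝒞) → ℝ)) = x := by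
      intro U x
      funext e
      simp [L, LinearMap.funLeft_apply]
    let M : W ≃ₗ[ℝ] W := LinearEquiv.ofLinearMap ((L U).restrict (hLW U))
      ((L U.symm).restrict (hLW U.symm))
      (by ext1 x; exact Subtype.ext (hinv U.symm x)) (by ext1 x; exact Subtype.ext (hinv U x))
    refine ⟨Φ.toLinearEquiv.symm ≪≫ₗ M ≪≫ₗ Φ.toLinearEquiv, fun r => ?_⟩
    have : M (ν r) = ν (r ≫ U.hom) := Subtype.ext (hL U r)
    simp [this]

end

namespace IsCoordinates

variable {A : 𝒞} {V : Type*} [NormedAddCommGroup V] [InnerProductSpace ℝ V]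
  {v : (𝟙_ 𝒞 ⟶ A) → V}

theorem exists_iso_symmetry (hv : IsCoordinates v) (hc : Causal 𝒞) (U : A ≅ A) :
    ∃ g : V ≃ₗ[ℝ] V, g '' stateBody v = stateBody v ∧ ∀ r, v (r ≫ U.hom) = g (v r) := by
  obtain ⟨g, hg⟩ := hv.exists_symmetry U
  refine ⟨g, Set.Subset.antisymm ?_ ?_, hg⟩
  · rintro _ ⟨_, ⟨s, hs, rfl⟩, rfl⟩
    exact ⟨s ≫ U.hom, IsDeterministic.comp hs (.of_iso hc U), hg s⟩
  · rintro _ ⟨s, hs, rfl⟩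
    refine ⟨v (s ≫ U.inv), ⟨_, IsDeterministic.comp hs (.of_iso hc U.symm), rfl⟩, ?_⟩
    rw [← hg]; simp

/-- A convex decomposition is realised by a biased coin followed by classical control, and purity
makes its outcomes proportional to `s`. -/
theorem extreme_of_isPure (hv : IsCoordinates v) (hc : Causal 𝒞)
    (hcontrol : ClassicalControl 𝒞) (hnores : NoRestriction 𝒞) {s : 𝟙_ 𝒞 ⟶ A}
    (hs : IsPure s) : v s ∈ (stateBody v).extremePoints ℝ := by
  refine ⟨⟨s, hs.1, rfl⟩, ?_⟩
  rintro _ ⟨σ, hσ, rfl⟩ _ ⟨τ, hτ, rfl⟩ ⟨a, b, ha, hb, hab, hseg⟩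
  obtain ⟨r, hr, hrσ, -, ω, hω, hsum, h⟩ :=
    exists_convex_combination hcontrol hnores ha.le (by linarith) hσ hτ
  have hωs : ω = s := by
    refine hv.injective ?_
    rw [← hseg]
    exact hv.combination _ _ _ _ _ fun e => by rw [h, ← hab]; ring
  subst hωs
  obtain ⟨c, hcr⟩ := hs.2 Bool r hr hsum true
  have h1 := hcr (discard hc A)
  rw [hrσ, hσ.prob_discard hc, hs.1.prob_discard hc, mul_one, mul_one] at h1
  subst h1
  refine congrArg v (state_ext fun e => ?_)
  have := hcr e
  rw [hrσ] at this
  exact mul_left_cancel₀ ha.ne' this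

/-- Merging all outcomes except `i` and normalising both parts turns a preparation into a convex
decomposition. The cases where one part has probability zero are separate. -/
theorem isPure_of_extreme (hv : IsCoordinates v) (hc : Causal 𝒞)
    (hcontrol : ClassicalControl 𝒞) (hclosed : ClosedStates 𝒞) {s : 𝟙_ 𝒞 ⟶ A}
    (hs : IsState s) (hext : v s ∈ (stateBody v).extremePoints ℝ) : IsPure s := by
  classical
  refine ⟨hs, fun ι _ r hr hsum i => ?_⟩
  have htot := fun e => hsum.prob_state e
  have hsplit : ∀ e, prob (s ≫ e) =
      prob (r i ≫ e) + ∑ j ∈ Finset.univ.erase i, prob (r j ≫ e) := fun e => by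
    rw [htot, Finset.add_sum_erase _ (fun j => prob (r j ≫ e)) (Finset.mem_univ i)]
  have hd := hsplit (discard hc A)
  rw [hs.prob_discard hc] at hd
  by_cases h0 : prob (r i ≫ discard hc A) = 0
  · exact ⟨0, fun e => by rw [zero_mul]; exact eq_of_prob_discard_eq_zero hc h0 e⟩
  by_cases h1 : ∑ j ∈ Finset.univ.erase i, prob (r j ≫ discard hc A) = 0
  · refine ⟨1, fun e => ?_⟩
    rw [one_mul, hsplit, left_eq_add]
    rw [Finset.sum_eq_zero_iff_of_nonneg fun _ _ => prob_nonneg _] at h1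
    exact Finset.sum_eq_zero fun j hj => eq_of_prob_discard_eq_zero hc (h1 j hj) e
  have hsurj : Function.Surjective fun j => decide (j = i) := by
    intro b
    cases b with
    | true => exact ⟨i, by simp⟩
    | false =>
      by_contra hno
      refine h1 (Finset.sum_eq_zero fun j hj => absurd ⟨j, ?_⟩ hno)
      simpa using Finset.ne_of_mem_erase hj
  obtain ⟨g, -, hg⟩ := exists_coarse r _ hsurj hr
  have hgrest : ∀ e, prob (g false ≫ e) = ∑ j ∈ Finset.univ.erase i, prob (r j ≫ e) := by
    intro e
    have := hg false (𝟙_ 𝒞) (ρ_ _).inv ((ρ_ A).hom ≫ e)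
    simp only [MonoidalCategory.whiskerRight_id, Category.assoc, Iso.inv_hom_id_assoc,
      decide_eq_false_iff_not] at this
    rw [this]
    refine Finset.sum_congr ?_ fun _ _ => rfl
    ext j; simp
  obtain ⟨σ, hσ, hσr⟩ := exists_normalization hc hcontrol hclosed (r i) h0
  obtain ⟨τ, hτ, hτr⟩ := exists_normalization hc hcontrol hclosed (g false)
    (by rw [hgrest]; exact h1)
  have hcomb := hv.combination s σ τ _ _ fun e => by rw [hsplit, ← hgrest, hσr, hτr]
  have hσs : v σ = v s := by
    refine hext.2 ⟨σ, hσ, rfl⟩ ⟨τ, hτ, rfl⟩ ⟨_, _, lt_of_le_of_ne (prob_nonneg _) (Ne.symm h0),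
      lt_of_le_of_ne (prob_nonneg _) (Ne.symm ?_), ?_, hcomb.symm⟩
    · rw [hgrest]; exact h1
    · rw [hgrest, ← hd]
  exact ⟨_, fun e => by rw [hσr e, hv.injective hσs]⟩

theorem exists_pure (hv : IsCoordinates v) (hc : Causal 𝒞)
    (hcontrol : ClassicalControl 𝒞) (hclosed : ClosedStates 𝒞) {x : V}
    (hx : x ∈ (stateBody v).extremePoints ℝ) : ∃ s, IsPure s ∧ v s = x := by
  obtain ⟨s, hs, rfl⟩ := hx.1
  exact ⟨s, hv.isPure_of_extreme hc hcontrol hclosed hs hx, rfl⟩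

theorem exists_unit (hv : IsCoordinates v) (hc : Causal 𝒞) :
    ∃ u : V →ₗ[ℝ] ℝ, (∀ r, u (v r) = prob (r ≫ discard hc A)) ∧ ∀ x ∈ stateBody v, u x = 1 := by
  obtain ⟨u, hu⟩ := hv.exists_functional (discard hc A)
  refine ⟨u, hu, ?_⟩
  rintro _ ⟨s, hs, rfl⟩
  rw [hu, hs.prob_discard hc]

theorem distinguishable_of_functionals (hv : IsCoordinates v) {ι : Type} [Fintype ι]
    [DecidableEq ι] (a : ι → V →ₗ[ℝ] ℝ)
    (ha : ∀ x ∈ stateBody v, (∀ i, 0 ≤ a i x) ∧ ∑ i, a i x = 1) (s : ι → (𝟙_ 𝒞 ⟶ A))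
    (hs : ∀ i, IsPure (s i)) (has : ∀ i j, a j (v (s i)) = if i = j then 1 else 0) :
    IsPureDistinguishable s := by
  obtain ⟨e, he, hp⟩ := hv.exists_test a ha
  refine ⟨hs, e, he, fun i => ?_, fun i j hij => ?_⟩
  · rw [hp _ (hs i).1, has, if_pos rfl]
  · rw [hp _ (hs i).1, has, if_neg hij]

theorem transitiveOnExtreme (hv : IsCoordinates v) (hc : Causal 𝒞)
    (hcontrol : ClassicalControl 𝒞) (hclosed : ClosedStates 𝒞) (hsymm : StrongSymmetry 𝒞) :
    ConvexBody.TransitiveOnExtreme (stateBody v) := by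
  intro a ha b hb
  obtain ⟨u, -, hu⟩ := hv.exists_unit hc
  obtain ⟨s, hs, rfl⟩ := hv.exists_pure hc hcontrol hclosed ha
  obtain ⟨t, ht, rfl⟩ := hv.exists_pure hc hcontrol hclosed hb
  have key : ∀ r : 𝟙_ 𝒞 ⟶ A, IsPure r → IsPureDistinguishable fun _ : Fin 1 => r := by
    intro r hr
    refine hv.distinguishable_of_functionals (fun _ => u) (fun x hx => ?_) _ (fun _ => hr)
      fun i j => ?_
    · simp [hu x hx]
    · rw [hu _ ⟨r, hr.1, rfl⟩, if_pos (Subsingleton.elim i j)]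
  obtain ⟨U, hU⟩ := hsymm A 1 _ _ (key s hs) (key t ht)
  obtain ⟨g, hg, hgv⟩ := hv.exists_iso_symmetry hc U
  exact ⟨g, hg, by rw [← hgv, hU 0]⟩

theorem pair_distinguishable (hv : IsCoordinates v) (hc : Causal 𝒞) {s t : 𝟙_ 𝒞 ⟶ A}
    (hs : IsPure s) (ht : IsPure t)
    (h : ConvexBody.Separated (stateBody v) (v s) (v t)) : IsPureDistinguishable ![s, t] := by
  obtain ⟨u, -, hu⟩ := hv.exists_unit hc
  obtain ⟨f, hf, hf1, hf0⟩ := h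
  refine hv.distinguishable_of_functionals ![f, u - f] (fun x hx => ⟨fun i => ?_, ?_⟩) _
    (fun i => ?_) fun i j => ?_
  · have := hf x hx
    fin_cases i <;> simp [hu x hx, this]
  · simp [hu x hx]
  · fin_cases i <;> simp [hs, ht]
  · have h1 := hu _ ⟨s, hs.1, rfl⟩
    have h2 := hu _ ⟨t, ht.1, rfl⟩
    fin_cases i <;> fin_cases j <;> simp [h1, h2, hf1, hf0]

theorem bitSymmetric (hv : IsCoordinates v) (hc : Causal 𝒞)
    (hcontrol : ClassicalControl 𝒞) (hclosed : ClosedStates 𝒞) (hsymm : StrongSymmetry 𝒞) :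
    ConvexBody.BitSymmetric (stateBody v) := by
  intro a ha b hb a' ha' b' hb' hab hab'
  obtain ⟨s, hs, rfl⟩ := hv.exists_pure hc hcontrol hclosed ha
  obtain ⟨t, ht, rfl⟩ := hv.exists_pure hc hcontrol hclosed hb
  obtain ⟨s', hs', rfl⟩ := hv.exists_pure hc hcontrol hclosed ha'
  obtain ⟨t', ht', rfl⟩ := hv.exists_pure hc hcontrol hclosed hb'
  obtain ⟨U, hU⟩ := hsymm A 2 _ _ (hv.pair_distinguishable hc hs ht hab)
    (hv.pair_distinguishable hc hs' ht' hab')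
  obtain ⟨g, hg, hgv⟩ := hv.exists_iso_symmetry hc U
  refine ⟨g, hg, ?_, ?_⟩
  · rw [← hgv]; exact congrArg v (hU 0)
  · rw [← hgv]; exact congrArg v (hU 1)

end IsCoordinates

theorem exists_isPure (hc : Causal 𝒞) (hcontrol : ClassicalControl 𝒞)
    (hclosed : ClosedStates 𝒞) (hnores : NoRestriction 𝒞) (hfin : FiniteDimensionalStates 𝒞)
    {A : 𝒞} (r : 𝟙_ 𝒞 ⟶ A) : ∃ s : 𝟙_ 𝒞 ⟶ A, IsPure s := by
  obtain ⟨d, v, hv⟩ := exists_coordinates hc hcontrol hclosed hnores hfin A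
  obtain ⟨s, hs⟩ := exists_state_of_hom r
  obtain ⟨x, hx⟩ := hv.compact.extremePoints_nonempty ⟨v s, s, hs, rfl⟩
  obtain ⟨t, ht, -⟩ := hv.exists_pure hc hcontrol hclosed hx
  exact ⟨t, ht⟩

end OperationalTheory

/-! ### Purification: channels, steering, faithfulness and compression -/

namespace OperationalTheory

variable {𝒞 : Type u} [Category.{v} 𝒞] [MonoidalCategory 𝒞] [SymmetricCategory 𝒞]
  [OperationalTheory 𝒞]

theorem IsPure.comp_iso {A B : 𝒞} {s : 𝟙_ 𝒞 ⟶ A} (hs : IsPure s) (hc : Causal 𝒞)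
    (U : A ≅ B) : IsPure (s ≫ U.hom) := by
  refine ⟨IsDeterministic.comp hs.1 (.of_iso hc U), fun ι _ r hr hsum i => ?_⟩
  obtain ⟨c, h⟩ := hs.2 ι _ (hr.comp_right (.of_iso hc U.symm))
    (isSum_of_prob_state fun e => by
      have := hsum.prob_state (U.inv ≫ e)
      simpa using this) i
  exact ⟨c, fun e => by simpa using h (U.hom ≫ e)⟩

omit [SymmetricCategory 𝒞] [OperationalTheory 𝒞] in
/-- Preparing a state in parallel, as a transformation acting on the first system only. -/
theorem prodState_eq {X Y : 𝒞} (Ψ : 𝟙_ 𝒞 ⟶ X) (ξ : 𝟙_ 𝒞 ⟶ Y) :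
    (λ_ (𝟙_ 𝒞)).inv ≫ (Ψ ⊗ₘ ξ) = Ψ ≫ (ρ_ X).inv ≫ X ◁ ξ := by
  rw [MonoidalCategory.tensorHom_def, unitors_inv_equal, rightUnitor_inv_naturality_assoc]

omit [SymmetricCategory 𝒞] [OperationalTheory 𝒞] in
theorem comp_scalar {A : 𝒞} (τ : 𝟙_ 𝒞 ⟶ A) (z : 𝟙_ 𝒞 ⟶ 𝟙_ 𝒞) :
    τ ≫ (ρ_ A).inv ≫ A ◁ z = z ≫ τ ≫ (ρ_ A).inv := by
  rw [rightUnitor_inv_naturality, rightUnitor_inv_naturality_assoc, ← whisker_exchange,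
    ← unitors_inv_equal, ← leftUnitor_inv_naturality_assoc]

theorem prob_scalar_comp {A : 𝒞} (z : 𝟙_ 𝒞 ⟶ 𝟙_ 𝒞) (τ : 𝟙_ 𝒞 ⟶ A) (e : A ⟶ 𝟙_ 𝒞) :
    prob (z ≫ τ ≫ e) = prob z * prob (τ ≫ e) := prob_comp _ _

/-- Every state is a component of a decomposition of `μ`. -/
def IsCompletelyMixed {A : 𝒞} (μ : 𝟙_ 𝒞 ⟶ A) : Prop :=
  IsState μ ∧ ∀ σ : 𝟙_ 𝒞 ⟶ A, IsState σ → ∃ p : ℝ, 0 < p ∧ p ≤ 1 ∧ ∃ τ, IsState τ ∧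
    ∀ e, prob (μ ≫ e) = p * prob (σ ≫ e) + (1 - p) * prob (τ ≫ e)

section

variable (hc : Causal 𝒞) (hcontrol : ClassicalControl 𝒞) (hclosed : ClosedStates 𝒞)
  (hnores : NoRestriction 𝒞) (hfin : FiniteDimensionalStates 𝒞) (hprod : PureProducts 𝒞)
  (hpur : Purification 𝒞)

include hc hpur in
theorem exists_purification {X Z : 𝒞} {s : 𝟙_ 𝒞 ⟶ X ⊗ Z} (hs : IsState s) :
    ∃ (G : 𝒞) (ψ : 𝟙_ 𝒞 ⟶ X ⊗ (Z ⊗ G)), IsPure ψ ∧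
      ψ ≫ X ◁ (Z ◁ discard hc G ≫ (ρ_ Z).hom) = s := by
  obtain ⟨G, ψ, hψ, hm⟩ := hpur.1 _ s hs
  refine ⟨G, ψ ≫ (α_ X Z G).hom, hψ.comp_iso hc _, ?_⟩
  rw [← hm _ (discard_isDeterministic hc G)]
  simp

include hc hprod in
theorem isPure_adjoin {X Y Z : 𝒞} {Ψ : 𝟙_ 𝒞 ⟶ X ⊗ Y} {ξ : 𝟙_ 𝒞 ⟶ Z} (hΨ : IsPure Ψ)
    (hξ : IsPure ξ) : IsPure (Ψ ≫ X ◁ ((ρ_ Y).inv ≫ Y ◁ ξ)) := by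
  have := (hprod _ _ Ψ ξ hΨ hξ).comp_iso hc (α_ X Y Z)
  rw [prodState, prodState_eq] at this
  simpa using this

include hc hprod hpur hcontrol hclosed hnores hfin

/-- Uniqueness of purification needs equal purifying systems. Adjoining pure states of `Z` and of
`Y` makes both systems `Y ⊗ Z`; discarding `Y` at the end leaves a channel. -/
theorem exists_channel_of_pure {X Y Z : 𝒞} {Ψ : 𝟙_ 𝒞 ⟶ X ⊗ Y} {Φ : 𝟙_ 𝒞 ⟶ X ⊗ Z}
    (hΨ : IsPure Ψ) (hΦ : IsPure Φ) (h : Ψ ≫ X ◁ discard hc Y = Φ ≫ X ◁ discard hc Z) :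
    ∃ D : Y ⟶ Z, IsDeterministic D ∧ Ψ ≫ X ◁ D = Φ := by
  obtain ⟨ξ, hξ⟩ := exists_isPure hc hcontrol hclosed hnores hfin
    (Φ ≫ discard hc X ▷ Z ≫ (λ_ Z).hom)
  obtain ⟨ξ', hξ'⟩ := exists_isPure hc hcontrol hclosed hnores hfin
    (Ψ ≫ discard hc X ▷ Y ≫ (λ_ Y).hom)
  have h1 : IsDeterministic ((ρ_ Y).inv ≫ Y ◁ ξ) :=
    (IsDeterministic.of_iso hc (ρ_ Y).symm).comp (hξ.1.whiskerLeft Y)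
  have h2 : IsDeterministic (((ρ_ Z).inv ≫ Z ◁ ξ') ≫ (β_ Z Y).hom) :=
    ((IsDeterministic.of_iso hc (ρ_ Z).symm).comp (hξ'.1.whiskerLeft Z)).comp
      (IsDeterministic.of_iso hc (β_ Z Y))
  have hp1 := isPure_adjoin hc hprod hΨ hξ
  have hp2 := (isPure_adjoin hc hprod hΦ hξ').comp_iso hc (whiskerLeftIso X (β_ Z Y))
  rw [whiskerLeftIso_hom, Category.assoc, ← whiskerLeft_comp] at hp2
  obtain ⟨T, hT⟩ := hpur.2 _ _ (Ψ ≫ X ◁ discard hc Y ≫ (ρ_ X).hom) _ _ hp1 hp2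
    (fun d hd => by
      rw [hd.eq_discard hc, Category.assoc, ← whiskerLeft_comp_assoc, h1.comp_discard hc])
    (fun d hd => by
      rw [hd.eq_discard hc, Category.assoc, ← whiskerLeft_comp_assoc, h2.comp_discard hc,
        reassoc_of% h])
  have hdY := discard_isDeterministic hc Y
  refine ⟨((ρ_ Y).inv ≫ Y ◁ ξ) ≫ T.hom ≫ discard hc Y ▷ Z ≫ (λ_ Z).hom,
    h1.comp ((IsDeterministic.of_iso hc T).comp ((hdY.whiskerRight Z).comp
      (IsDeterministic.of_iso hc (λ_ Z)))), ?_⟩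
  have hin : (((ρ_ Z).inv ≫ Z ◁ ξ') ≫ (β_ Z Y).hom) ≫ discard hc Y ▷ Z ≫ (λ_ Z).hom = 𝟙 Z := by
    have h3 : ξ' ≫ discard hc Y = 𝟙 _ := by
      rw [IsDeterministic.comp_discard hc hξ'.1, discard_unit]
    simp only [Category.assoc]
    rw [← BraidedCategory.braiding_naturality_right_assoc, ← whiskerLeft_comp_assoc, h3]
    simp
  rw [whiskerLeft_comp X ((ρ_ Y).inv ≫ Y ◁ ξ), whiskerLeft_comp X T.hom, ← Category.assoc Ψ,
    ← Category.assoc _ (X ◁ T.hom), ← hT, Category.assoc Φ, ← whiskerLeft_comp, hin,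
    MonoidalCategory.whiskerLeft_id, Category.comp_id]

/-- A purification determines all other extensions of its marginal, up to a channel on the
purifying system. -/
theorem exists_channel {X Y Z : 𝒞} {Ψ : 𝟙_ 𝒞 ⟶ X ⊗ Y} {Φ : 𝟙_ 𝒞 ⟶ X ⊗ Z}
    (hΨ : IsPure Ψ) (hΦ : IsState Φ) (h : Ψ ≫ X ◁ discard hc Y = Φ ≫ X ◁ discard hc Z) :
    ∃ D : Y ⟶ Z, IsDeterministic D ∧ Ψ ≫ X ◁ D = Φ := by
  obtain ⟨G, ψ, hψ, hψΦ⟩ := exists_purification hc hpur hΦ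
  have hdet : IsDeterministic (Z ◁ discard hc G ≫ (ρ_ Z).hom) :=
    ((discard_isDeterministic hc G).whiskerLeft Z).comp (.of_iso hc (ρ_ Z))
  obtain ⟨D, hD, hDψ⟩ := exists_channel_of_pure hc hcontrol hclosed hnores hfin hprod hpur
    hΨ hψ (by
      rw [h, ← hψΦ, Category.assoc, ← whiskerLeft_comp, hdet.comp_discard hc])
  exact ⟨D ≫ Z ◁ discard hc G ≫ (ρ_ Z).hom, hD.comp hdet, by
    rw [whiskerLeft_comp, ← Category.assoc, hDψ, hψΦ]⟩

/-- A pure state purifies itself with trivial purifying system, and a channel out of the unit is a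
preparation. -/
theorem eq_product_of_pure_marginal {F Y : 𝒞} {φ : 𝟙_ 𝒞 ⟶ F} {θ : 𝟙_ 𝒞 ⟶ F ⊗ Y}
    (hφ : IsPure φ) (hθ : IsState θ) (h : θ ≫ F ◁ discard hc Y = φ ≫ (ρ_ F).inv) :
    ∃ D : 𝟙_ 𝒞 ⟶ Y, θ = φ ≫ (ρ_ F).inv ≫ F ◁ D := by
  obtain ⟨D, -, hD⟩ := exists_channel hc hcontrol hclosed hnores hfin hprod hpur
    (hφ.comp_iso hc (ρ_ F).symm) hθ (by
      rw [h, discard_unit, MonoidalCategory.whiskerLeft_id, Category.comp_id]; rfl)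
  exact ⟨D, by rw [← hD, Category.assoc]; rfl⟩

/-- Every extension of every state of `A` is steered, with nonzero probability, from a
purification of a completely mixed state. -/
theorem exists_steering {A E E' F : 𝒞} {φ₀ φ₁ : 𝟙_ 𝒞 ⟶ F} (hφ₀ : IsState φ₀)
    (hφ₁ : IsState φ₁) {d₀ : F ⟶ 𝟙_ 𝒞} (hd₀ : prob (φ₀ ≫ d₀) = 1) (hd₁ : prob (φ₁ ≫ d₀) = 0)
    {μ : 𝟙_ 𝒞 ⟶ A} (hμ : IsCompletelyMixed μ) {Ψ : 𝟙_ 𝒞 ⟶ A ⊗ E} (hΨ : IsPure Ψ)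
    (hΨμ : Ψ ≫ A ◁ discard hc E = μ ≫ (ρ_ A).inv) {R : 𝟙_ 𝒞 ⟶ A ⊗ E'} (hR : IsState R) :
    ∃ p : 𝟙_ 𝒞 ⟶ 𝟙_ 𝒞, prob p ≠ 0 ∧ ∃ b : E ⟶ E', Ψ ≫ A ◁ b = p ≫ R := by
  have hdE' := (discard_isDeterministic hc E').whiskerLeft A
  obtain ⟨p, hp0, hp1, τ, hτ, hμp⟩ := hμ.2 (R ≫ A ◁ discard hc E' ≫ (ρ_ A).hom)
    (IsDeterministic.comp hR (hdE'.comp (.of_iso hc (ρ_ A))))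
  obtain ⟨κ, hκ⟩ := exists_state_of_hom (R ≫ discard hc A ▷ E' ≫ (λ_ E').hom)
  have h0 : IsDeterministic ((ρ_ E').inv ≫ E' ◁ φ₀) :=
    (IsDeterministic.of_iso hc (ρ_ E').symm).comp (IsDeterministic.whiskerLeft E' hφ₀)
  have h1 : IsDeterministic (φ₁ ≫ (λ_ F).inv ≫ κ ▷ F) :=
    IsDeterministic.comp hφ₁ ((IsDeterministic.of_iso hc (λ_ F).symm).comp
      (IsDeterministic.whiskerRight hκ F))
  have hτρ : IsDeterministic (τ ≫ (ρ_ A).inv) :=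
    IsDeterministic.comp hτ (.of_iso hc (ρ_ A).symm)
  -- An extension of `μ` in which the flag system `F` records which component occurred: `R` with
  -- flag `φ₀`, or `τ` with a dummy `κ` and flag `φ₁`. Testing the flag with `d₀` isolates `R`.
  obtain ⟨-, -, -, -, ω, hω, -, hωe⟩ := exists_convex_combination hcontrol hnores hp0.le hp1
    (σ := R ≫ A ◁ ((ρ_ E').inv ≫ E' ◁ φ₀))
    (τ := (τ ≫ (ρ_ A).inv) ≫ A ◁ (φ₁ ≫ (λ_ F).inv ≫ κ ▷ F))
    (IsDeterministic.comp hR (h0.whiskerLeft A)) (hτρ.comp (h1.whiskerLeft A))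
  obtain ⟨D, -, hD⟩ := exists_channel hc hcontrol hclosed hnores hfin hprod hpur hΨ hω (by
    rw [hΨμ]
    refine state_ext fun e => ?_
    rw [Category.assoc μ, Category.assoc ω, hωe, hμp, Category.assoc R (A ◁ (_ ≫ _)),
      ← whiskerLeft_comp_assoc, h0.comp_discard hc, Category.assoc (τ ≫ (ρ_ A).inv),
      ← whiskerLeft_comp_assoc A (φ₁ ≫ _), h1.comp_discard hc, discard_unit]
    simp)
  obtain ⟨c, -, hcp, -⟩ := exists_coin hnores hp0.le hp1
  refine ⟨c true, hcp ▸ hp0.ne', D ≫ E' ◁ d₀ ≫ (ρ_ E').hom, ?_⟩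
  rw [whiskerLeft_comp, ← Category.assoc, hD]
  refine state_ext fun e => ?_
  have e0 : ((ρ_ E').inv ≫ E' ◁ φ₀) ≫ E' ◁ d₀ ≫ (ρ_ E').hom = 𝟙 _ := by
    have : φ₀ ≫ d₀ = 𝟙 _ := scalar_ext (by rw [hd₀, prob_id])
    rw [Category.assoc, ← whiskerLeft_comp_assoc, this]
    simp
  have e1 : (φ₁ ≫ (λ_ F).inv ≫ κ ▷ F) ≫ E' ◁ d₀ ≫ (ρ_ E').hom = (φ₁ ≫ d₀) ≫ κ := by
    simp only [Category.assoc]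
    rw [← whisker_exchange_assoc, ← leftUnitor_inv_naturality_assoc, rightUnitor_naturality,
      ← unitors_equal, Iso.inv_hom_id_assoc]
  rw [Category.assoc, hωe, Category.assoc R, ← whiskerLeft_comp_assoc, e0,
    Category.assoc (τ ≫ (ρ_ A).inv), ← whiskerLeft_comp_assoc A (φ₁ ≫ _), e1,
    whiskerLeft_comp_assoc, ← Category.assoc (τ ≫ (ρ_ A).inv), Category.assoc τ, comp_scalar]
  simp only [Category.assoc, MonoidalCategory.whiskerLeft_id, Category.id_comp]
  have := prob_scalar_comp (φ₁ ≫ d₀) τ ((ρ_ A).inv ≫ A ◁ κ ≫ e)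
  rw [hd₁, zero_mul, Category.assoc] at this
  rw [this, prob_scalar_comp, hcp, mul_zero, add_zero]

/-- Purifications of completely mixed states are dynamically faithful. -/
theorem hom_ext_of_faithful {A B E F : 𝒞} {φ₀ φ₁ : 𝟙_ 𝒞 ⟶ F} (hφ₀ : IsState φ₀)
    (hφ₁ : IsState φ₁) {d₀ : F ⟶ 𝟙_ 𝒞} (hd₀ : prob (φ₀ ≫ d₀) = 1) (hd₁ : prob (φ₁ ≫ d₀) = 0)
    {μ : 𝟙_ 𝒞 ⟶ A} (hμ : IsCompletelyMixed μ) {Ψ : 𝟙_ 𝒞 ⟶ A ⊗ E} (hΨ : IsPure Ψ)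
    (hΨμ : Ψ ≫ A ◁ discard hc E = μ ≫ (ρ_ A).inv) {f g : A ⟶ B}
    (hfg : Ψ ≫ f ▷ E = Ψ ≫ g ▷ E) : f = g := by
  refine hom_ext_of_states fun E' r => state_ext fun e => ?_
  simp only [Category.assoc]
  by_cases hr : prob (r ≫ discard hc (A ⊗ E')) = 0
  · rw [eq_of_prob_discard_eq_zero hc hr, eq_of_prob_discard_eq_zero hc hr]
  obtain ⟨R, hR, hRr⟩ := exists_normalization hc hcontrol hclosed r hr
  obtain ⟨p, hp, b, hb⟩ := exists_steering hc hcontrol hclosed hnores hfin hprod hpur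
    hφ₀ hφ₁ hd₀ hd₁ hμ hΨ hΨμ hR
  have key : ∀ k : A ⟶ B, prob p * prob (R ≫ k ▷ E' ≫ e) =
      prob ((Ψ ≫ k ▷ E) ≫ B ◁ b ≫ e) := by
    intro k
    rw [← prob_scalar_comp, ← Category.assoc, ← hb]
    simp only [Category.assoc]
    rw [whisker_exchange_assoc]
  rw [hRr (f ▷ E' ≫ e), hRr (g ▷ E' ≫ e)]
  congr 1
  exact mul_left_cancel₀ hp (by rw [key, key, hfg])

/-- A measurement with two outcomes can be performed without disturbing the states on which
its first outcome is certain. -/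
theorem exists_compression {A F : 𝒞} {φ₀ φ₁ : 𝟙_ 𝒞 ⟶ F} (hφ₀ : IsPure φ₀)
    (hφ₁ : IsState φ₁) {d₀ : F ⟶ 𝟙_ 𝒞} (hd₀ : prob (φ₀ ≫ d₀) = 1) (hd₁ : prob (φ₁ ≫ d₀) = 0)
    {μ : 𝟙_ 𝒞 ⟶ A} (hμ : IsCompletelyMixed μ) {a : Bool → (A ⟶ 𝟙_ 𝒞)} (ha : IsTest a) :
    ∃ C : A ⟶ A, (∀ r : 𝟙_ 𝒞 ⟶ A, prob (r ≫ C ≫ discard hc A) = prob (r ≫ a true)) ∧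
      ∀ σ : 𝟙_ 𝒞 ⟶ A, IsState σ → prob (σ ≫ a false) = 0 → σ ≫ C = σ := by
  -- `M` measures `a` and writes the outcome into `F`. Below, `D` dilates `M` with environment `G`,
  -- and `D'` undoes `D`.
  obtain ⟨-, M, hM, hMsum⟩ := exists_controlled_sum hcontrol ha
    (fun b => bif b then φ₀ else φ₁) (by rintro (_ | _); exacts [hφ₁, hφ₀.1])
  have hMe : ∀ (r : 𝟙_ 𝒞 ⟶ A) (e : F ⟶ 𝟙_ 𝒞), prob (r ≫ M ≫ e) =
      prob (r ≫ a true) * prob (φ₀ ≫ e) + prob (r ≫ a false) * prob (φ₁ ≫ e) := by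
    intro r e
    rw [hMsum.prob_comp, Fintype.sum_bool]
    simp only [cond_true, cond_false, Category.assoc, ← prob_comp]
  obtain ⟨E, Ψ, hΨ, hΨm⟩ := hpur.1 A μ hμ.1
  have hΨμ : Ψ ≫ A ◁ discard hc E = μ ≫ (ρ_ A).inv := by
    rw [← hΨm _ (discard_isDeterministic hc E)]
    simp
  have hΨ' := hΨ.comp_iso hc (β_ A E)
  have hfaith : ∀ {B : 𝒞} {f g : A ⟶ B},
      (Ψ ≫ (β_ A E).hom) ≫ E ◁ f = (Ψ ≫ (β_ A E).hom) ≫ E ◁ g → f = g := by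
    intro B f g h
    refine hom_ext_of_faithful hc hcontrol hclosed hnores hfin hprod hpur hφ₀.1 hφ₁ hd₀ hd₁
      hμ hΨ hΨμ ?_
    rw [Category.assoc, Category.assoc, ← BraidedCategory.braiding_naturality_left,
      ← BraidedCategory.braiding_naturality_left, ← Category.assoc, ← Category.assoc] at h
    exact (cancel_mono _).mp h
  obtain ⟨G, R, hR, hRM⟩ := exists_purification hc hpur
    (s := (Ψ ≫ (β_ A E).hom) ≫ E ◁ M) (IsDeterministic.comp hΨ'.1 (hM.whiskerLeft E))
  have hdet : IsDeterministic (F ◁ discard hc G ≫ (ρ_ F).hom) :=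
    ((discard_isDeterministic hc G).whiskerLeft F).comp (.of_iso hc (ρ_ F))
  have hmarg : (Ψ ≫ (β_ A E).hom) ≫ E ◁ discard hc A = R ≫ E ◁ discard hc (F ⊗ G) := by
    rw [← hdet.comp_discard hc, whiskerLeft_comp, ← Category.assoc R, hRM,
      Category.assoc (Ψ ≫ (β_ A E).hom), ← whiskerLeft_comp, hM.comp_discard hc]
  obtain ⟨D, hDdet, hD⟩ := exists_channel hc hcontrol hclosed hnores hfin hprod hpur
    hΨ' hR.1 hmarg
  obtain ⟨D', hD'det, hD'⟩ := exists_channel hc hcontrol hclosed hnores hfin hprod hpur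
    hR hΨ'.1 hmarg.symm
  -- `Ψ` and `R` are both pure with the same marginal on `E`, so channels exist in both directions;
  -- faithfulness upgrades the round trip on `Ψ` to the identity.
  have hDD' : D ≫ D' = 𝟙 A := hfaith (by
    rw [whiskerLeft_comp, ← Category.assoc, hD, hD', MonoidalCategory.whiskerLeft_id,
      Category.comp_id])
  have hDM : D ≫ F ◁ discard hc G ≫ (ρ_ F).hom = M := hfaith (by
    rw [whiskerLeft_comp, ← Category.assoc, hD, hRM])
  -- Dilate, project the record onto `φ₀`, and undo the dilation. If the outcome is certain, the
  -- record is the pure state `φ₀`, hence uncorrelated with `G`, and the projection changes nothing.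
  refine ⟨D ≫ (d₀ ≫ φ₀) ▷ G ≫ D', fun r => ?_, fun σ hσ hσa => ?_⟩
  · have h1 : (d₀ ≫ φ₀) ▷ G ≫ discard hc (F ⊗ G) =
        F ◁ discard hc G ≫ (ρ_ F).hom ≫ d₀ := by
      have h2 := ((IsDeterministic.whiskerRight hφ₀.1 G).comp_discard hc)
      have h3 : discard hc (𝟙_ 𝒞 ⊗ G) = 𝟙_ 𝒞 ◁ discard hc G ≫ (λ_ _).hom :=
        ((((discard_isDeterministic hc G).whiskerLeft _).comp
          (.of_iso hc (λ_ (𝟙_ 𝒞))))).eq_discard hc |>.symm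
      rw [comp_whiskerRight, Category.assoc, h2, h3, ← whisker_exchange_assoc, unitors_equal,
        rightUnitor_naturality]
    have h4 : (D ≫ (d₀ ≫ φ₀) ▷ G ≫ D') ≫ discard hc A = M ≫ d₀ := by
      rw [← hDM]
      simp only [Category.assoc]
      rw [hD'det.comp_discard hc, h1]
    rw [h4, hMe, hd₀, hd₁, mul_one, mul_zero, add_zero]
  · have hσM : σ ≫ M = φ₀ := by
      refine state_ext fun e => ?_
      have h1 := sum_prob _ (ha.comp_left hσ)
      rw [Fintype.sum_bool, hσa, add_zero] at h1
      rw [Category.assoc, hMe, hσa, h1, one_mul, zero_mul, add_zero]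
    obtain ⟨Y, hY⟩ := eq_product_of_pure_marginal hc hcontrol hclosed hnores hfin hprod hpur
      hφ₀ (θ := σ ≫ D) (IsDeterministic.comp hσ hDdet) (by
        rw [← hσM, ← hDM]
        simp)
    have hfix : (σ ≫ D) ≫ (d₀ ≫ φ₀) ▷ G = σ ≫ D := by
      have h0 : φ₀ ≫ d₀ = 𝟙 _ := scalar_ext (by rw [hd₀, prob_id])
      rw [hY]
      simp only [Category.assoc]
      rw [whisker_exchange, ← rightUnitor_inv_naturality_assoc, Category.assoc,
        reassoc_of% h0]
    rw [← Category.assoc, ← Category.assoc, hfix, Category.assoc, hDD', Category.comp_id]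

end

end OperationalTheory

/-! ### Complete mixedness, maximal sets and the kick-back -/

namespace OperationalTheory

variable {𝒞 : Type u} [Category.{v} 𝒞] [MonoidalCategory 𝒞] [SymmetricCategory 𝒞]
  [OperationalTheory 𝒞]

section

variable {A : 𝒞} {V : Type*} [NormedAddCommGroup V] [InnerProductSpace ℝ V]
  {v : (𝟙_ 𝒞 ⟶ A) → V} {B : V →ₗ[ℝ] V →ₗ[ℝ] ℝ}

/-- The vector representing the deterministic effect is proportional to a completely mixed
state. -/
theorem exists_isCompletelyMixed (hv : IsCoordinates v)
    (hB : ConvexBody.IsSelfDualizing (stateBody v) B) {u : V →ₗ[ℝ] ℝ}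
    (hu : ∀ x ∈ stateBody v, u x = 1) {y : V} (hy : B y = u) {c : ℝ} {μ : 𝟙_ 𝒞 ⟶ A}
    (hμ : IsState μ) (hyμ : y = c • v μ) : IsCompletelyMixed μ := by
  refine ⟨hμ, fun σ hσ => ?_⟩
  have hσΩ : v σ ∈ stateBody v := ⟨σ, hσ, rfl⟩
  -- The bound `B ≤ 1` on states puts `y - v σ` in the cone; dividing by `c` exhibits `σ` inside `μ`
  -- with weight `c⁻¹`.
  obtain ⟨t, ht, _, ⟨τ, hτ, rfl⟩, hyσ⟩ := hB.mem_cone (y - v σ) (fun x hx => by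
    rw [map_sub, LinearMap.sub_apply, hy, hu x hx]
    linarith [hB.le_one _ hσΩ x hx])
  have h1 := congrArg u hyσ
  rw [map_sub, hyμ, map_smul, map_smul, hu _ ⟨μ, hμ, rfl⟩, hu _ hσΩ, hu _ ⟨τ, hτ, rfl⟩,
    smul_eq_mul, smul_eq_mul, mul_one, mul_one] at h1
  have hc : 0 < c := by linarith
  refine ⟨c⁻¹, by positivity, inv_le_one_of_one_le₀ (by linarith), τ, hτ, fun e => ?_⟩
  obtain ⟨f, hf⟩ := hv.exists_functional e
  have h2 := congrArg f hyσ
  rw [map_sub, hyμ, map_smul, map_smul, hf, hf, hf, smul_eq_mul, smul_eq_mul] at h2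
  field_simp
  linear_combination h2 - prob (τ ≫ e) * h1

variable [FiniteDimensional ℝ V] (hv : IsCoordinates v) (hc : Causal 𝒞)
  (hcontrol : ClassicalControl 𝒞) (hclosed : ClosedStates 𝒞)

include hv hc hcontrol hclosed

/-- A pure state and a state that are perfectly distinguishable. -/
theorem exists_flag (hnt : (stateBody v).Nontrivial)
    (hB : ConvexBody.IsSelfDualizing (stateBody v) B) {u : V →ₗ[ℝ] ℝ}
    (hu : ∀ x ∈ stateBody v, u x = 1) :
    ∃ φ₀ φ₁ : 𝟙_ 𝒞 ⟶ A, IsPure φ₀ ∧ IsState φ₁ ∧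
      ∃ d₀ : A ⟶ 𝟙_ 𝒞, prob (φ₀ ≫ d₀) = 1 ∧ prob (φ₁ ≫ d₀) = 0 := by
  obtain ⟨a, ha⟩ := hv.compact.extremePoints_nonempty hnt.nonempty
  obtain ⟨b, hb, hbmin⟩ :=
    ConvexBody.exists_extreme_minimizer hv.compact hnt.nonempty (B a)
  have hlt : B a b < 1 := by
    refine lt_of_le_of_ne (hB.le_one a ha.1 b hb.1) fun h => ?_
    have h1 : ∀ x ∈ stateBody v, x = a := fun x hx =>
      hB.eq_of_eq_one a ha x hx (le_antisymm (hB.le_one a ha.1 x hx) (h ▸ hbmin x hx))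
    obtain ⟨x, hx, z, hz, hxz⟩ := hnt
    exact hxz ((h1 x hx).trans (h1 z hz).symm)
  have hpos : 0 < 1 - B a b := sub_pos.mpr hlt
  -- `B a` rescaled to be 1 at its maximizer `a` and 0 at its minimizer `b`.
  let f : V →ₗ[ℝ] ℝ := (1 - B a b)⁻¹ • (B a - B a b • u)
  have hf : ∀ x ∈ stateBody v, f x = (1 - B a b)⁻¹ * (B a x - B a b) := fun x hx => by
    simp [f, hu x hx]
  have hf0 : ∀ x ∈ stateBody v, 0 ≤ f x := fun x hx => by
    rw [hf x hx]
    exact mul_nonneg (by positivity) (sub_nonneg.mpr (hbmin x hx))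
  have hf1 : ∀ x ∈ stateBody v, f x ≤ 1 := fun x hx => by
    rw [hf x hx, inv_mul_le_iff₀ hpos, mul_one]
    linarith [hB.le_one a ha.1 x hx]
  obtain ⟨e, -, he⟩ := hv.exists_test (fun b : Bool => bif b then f else u - f)
    (fun x hx => ⟨by
      rintro (_ | _)
      · simp [hu x hx, hf1 x hx]
      · simp [hf0 x hx], by simp [hu x hx]⟩)
  obtain ⟨s, hs, rfl⟩ := hv.exists_pure hc hcontrol hclosed ha
  obtain ⟨t, ht, rfl⟩ := hv.exists_pure hc hcontrol hclosed hb
  refine ⟨s, t, hs, ht.1, e true, ?_, ?_⟩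
  · rw [he s hs.1, cond_true, hf _ ha.1, hB.self_eq_one _ ha, inv_mul_cancel₀ hpos.ne']
  · rw [he t ht.1, cond_true, hf _ hb.1, sub_self, mul_zero]

omit [FiniteDimensional ℝ V] in
-- The witness is the effect "compress onto the complement of `c`, then test `f`". The outcome
-- `true` of the tests below is the complementary one, so the compression fixes states with `c = 0`.
theorem hasCompressions (hnores : NoRestriction 𝒞) (hfin : FiniteDimensionalStates 𝒞)
    (hprod : PureProducts 𝒞) (hpur : Purification 𝒞) {u : V →ₗ[ℝ] ℝ}
    (hu : ∀ x ∈ stateBody v, u x = 1) {F : 𝒞} {φ₀ φ₁ : 𝟙_ 𝒞 ⟶ F} (hφ₀ : IsPure φ₀)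
    (hφ₁ : IsState φ₁) {d₀ : F ⟶ 𝟙_ 𝒞} (hd₀ : prob (φ₀ ≫ d₀) = 1) (hd₁ : prob (φ₁ ≫ d₀) = 0)
    {μ : 𝟙_ 𝒞 ⟶ A} (hμ : IsCompletelyMixed μ) :
    ConvexBody.HasCompressions (stateBody v) u := by
  have htest : ∀ f : V →ₗ[ℝ] ℝ, (∀ x ∈ stateBody v, 0 ≤ f x ∧ f x ≤ 1) →
      ∃ e : Bool → (A ⟶ 𝟙_ 𝒞), IsTest e ∧
        ∀ s, IsState s → prob (s ≫ e true) = (u - f) (v s) ∧ prob (s ≫ e false) = f (v s) := by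
    intro f hf
    obtain ⟨e, he, hp⟩ := hv.exists_test (fun b : Bool => bif b then u - f else f)
      (fun x hx => ⟨by
        rintro (_ | _)
        · simp [hf x hx]
        · simp [hu x hx, hf x hx], by simp [hu x hx]⟩)
    exact ⟨e, he, fun s hs => ⟨hp s hs true, hp s hs false⟩⟩
  intro c f hc01 hf01
  obtain ⟨a, ha, hap⟩ := htest c hc01
  obtain ⟨b, -, hbp⟩ := htest f hf01
  obtain ⟨C, hC, hCfix⟩ := exists_compression hc hcontrol hclosed hnores hfin hprod hpur
    hφ₀ hφ₁ hd₀ hd₁ hμ ha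
  obtain ⟨g, hg⟩ := hv.exists_functional (C ≫ b false)
  refine ⟨g, ?_, ?_⟩
  · rintro _ ⟨σ, hσ, rfl⟩
    rw [hg]
    refine ⟨prob_nonneg _, ?_⟩
    rw [← (hap σ hσ).1, ← hC, ← Category.assoc, ← Category.assoc]
    exact prob_comp_le hc _ _
  · rintro _ ⟨σ, hσ, rfl⟩ hcσ
    rw [hg, ← Category.assoc, hCfix σ hσ (by rw [(hap σ hσ).2, hcσ]), (hbp σ hσ).2]

variable {ι : Type} [Finite ι] {i : ι → (𝟙_ 𝒞 ⟶ A)}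

omit [FiniteDimensional ℝ V] hclosed in
theorem orthogonal_of_distinguishable (hnores : NoRestriction 𝒞)
    (hB : ConvexBody.IsSelfDualizing (stateBody v) B) (hi : IsPureDistinguishable i) (j k : ι)
    (hjk : j ≠ k) : B (v (i j)) (v (i k)) = 0 := by
  have hext := fun k => hv.extreme_of_isPure hc hcontrol hnores (hi.1 k)
  obtain ⟨e, -, he1, he0⟩ := hi.2
  obtain ⟨f, hf⟩ := hv.exists_functional (e j)
  refine hB.eq_zero_of_separated _ (hext j) _ (hext k) ⟨f, ?_, ?_, ?_⟩
  · rintro _ ⟨s, hs, rfl⟩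
    rw [hf]
    exact ⟨prob_nonneg _, hs.prob_le_one hc _⟩
  · rw [hf, he1]
  · rw [hf, he0 k j hjk.symm]

/-- The states of a maximal perfectly distinguishable set sum up to the representative of the
deterministic effect. -/
theorem sum_maximal_eq [Fintype ι] (hnores : NoRestriction 𝒞)
    (hB : ConvexBody.IsSelfDualizing (stateBody v) B) {u : V →ₗ[ℝ] ℝ}
    (hu : ∀ x ∈ stateBody v, u x = 1) {y : V} (hy : B y = u)
    (hcomp : ConvexBody.HasCompressions (stateBody v) u)
    (hi : IsMaximalPureDistinguishable i) : ∑ k, v (i k) = y := by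
  classical
  have hort := orthogonal_of_distinguishable hv hc hcontrol hnores hB hi.1
  have hext := fun k => hv.extreme_of_isPure hc hcontrol hnores (hi.1.1 k)
  have hnn := hB.sub_sum_nonneg hu hcomp hy (fun k => v (i k)) hext hort Finset.univ
  obtain ⟨t, ht, x, hx, hz⟩ := hB.mem_cone _ hnn
  rcases ht.eq_or_lt with rfl | htpos
  · rw [zero_smul] at hz
    exact (sub_eq_zero.mp hz).symm
  exfalso
  have hself : ∀ j, B (∑ k, v (i k)) (v (i j)) = 1 := by
    intro j
    rw [map_sum, LinearMap.sum_apply, Finset.sum_eq_single_of_mem j (Finset.mem_univ j)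
      fun k _ hkj => hort k j hkj, hB.self_eq_one _ (hext j)]
  have hx0 : B (∑ k, v (i k)) x = 0 := by
    have h1 : B (∑ k, v (i k)) (y - ∑ k, v (i k)) = 0 := by
      rw [map_sub, map_sum (B (∑ k, v (i k))), Finset.sum_congr rfl fun j _ => hself j,
        map_sum, LinearMap.sum_apply,
        Finset.sum_congr rfl fun j _ => hB.apply_unit hu hy (hext j).1, sub_self]
    rw [hz, map_smul, smul_eq_mul] at h1
    exact (mul_eq_zero.mp h1).resolve_left htpos.ne'
  -- A nonzero remainder makes the minimum of this functional 0. An extreme minimizer is orthogonal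
  -- to every `i k`, and the remainder represents the extra effect that detects it.
  obtain ⟨w, hw, hwmin⟩ := ConvexBody.exists_extreme_minimizer hv.compact ⟨x, hx⟩
    (B (∑ k, v (i k)))
  have hwk : ∀ k, B (v (i k)) w = 0 := by
    have h1 := hwmin x hx
    have h2 : ∑ k, B (v (i k)) w = 0 := by
      refine le_antisymm ?_
        (Finset.sum_nonneg fun k _ => hB.nonneg _ (hext k).1 _ hw.1)
      rwa [hx0, map_sum, LinearMap.sum_apply] at h1
    rw [Finset.sum_eq_zero_iff_of_nonneg fun k _ => hB.nonneg _ (hext k).1 _ hw.1] at h2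
    exact fun k => h2 k (Finset.mem_univ k)
  obtain ⟨s, hs, rfl⟩ := hv.exists_pure hc hcontrol hclosed hw
  refine hi.2 ⟨s, hv.distinguishable_of_functionals
    (fun o : Option ι => o.elim (B (y - ∑ k, v (i k))) fun k => B (v (i k)))
    (fun z hz => ⟨?_, ?_⟩) _ ?_ ?_⟩
  · rintro (_ | k)
    · exact hnn z hz
    · exact hB.nonneg _ (hext k).1 z hz
  · rw [Fintype.sum_option]
    simp only [Option.elim]
    rw [map_sub, LinearMap.sub_apply, hy, hu z hz, map_sum, LinearMap.sum_apply,
      sub_add_cancel]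
  · rintro (_ | k)
    · exact hs
    · exact hi.1.1 k
  · rintro (_ | j) (_ | k)
    · simp only [Option.elim, if_true]
      rw [map_sub, LinearMap.sub_apply, hy, hu _ hw.1, map_sum, LinearMap.sum_apply,
        Finset.sum_eq_zero fun k _ => hwk k, sub_zero]
    · simp only [Option.elim, reduceCtorEq, if_false]
      exact hwk k
    · simp only [Option.elim, reduceCtorEq, if_false]
      rw [map_sub, LinearMap.sub_apply, hy, hu _ (hext j).1, hself, sub_self]
    · simp only [Option.elim, Option.some.injEq]
      split_ifs with hjk
      · rw [hjk, hB.self_eq_one _ (hext k)]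
      · exact hort k j (Ne.symm hjk)

end

section

variable (hc : Causal 𝒞) (hcontrol : ClassicalControl 𝒞) (hclosed : ClosedStates 𝒞)
  (hnores : NoRestriction 𝒞) (hfin : FiniteDimensionalStates 𝒞) (hprod : PureProducts 𝒞)
  (hpur : Purification 𝒞)

include hc hcontrol hclosed hnores hfin hprod hpur

/-- A reversible transformation of `A ⊗ B` that fixes `μ ⊗ s`, where `μ` is completely mixed and
`s` is pure, acts on all inputs with second component `s` as a transformation of `A`. -/
theorem exists_kickback {A B F : 𝒞} {φ₀ φ₁ : 𝟙_ 𝒞 ⟶ F} (hφ₀ : IsState φ₀)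
    (hφ₁ : IsState φ₁) {d₀ : F ⟶ 𝟙_ 𝒞} (hd₀ : prob (φ₀ ≫ d₀) = 1) (hd₁ : prob (φ₁ ≫ d₀) = 0)
    {μ : 𝟙_ 𝒞 ⟶ A} (hμ : IsCompletelyMixed μ) {s : 𝟙_ 𝒞 ⟶ B} (hs : IsPure s)
    (C : A ⊗ B ≅ A ⊗ B)
    (hC : μ ≫ ((ρ_ A).inv ≫ A ◁ s) ≫ C.hom = μ ≫ (ρ_ A).inv ≫ A ◁ s) :
    ∃ Q : A ⟶ A, Q ≫ (ρ_ A).inv ≫ A ◁ s = ((ρ_ A).inv ≫ A ◁ s) ≫ C.hom := by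
  obtain ⟨E, Ψ, hΨ, hΨm⟩ := hpur.1 A μ hμ.1
  have hΨμ : Ψ ≫ A ◁ discard hc E = μ ≫ (ρ_ A).inv := by
    rw [← hΨm _ (discard_isDeterministic hc E)]
    simp
  have hpure : IsPure (Ψ ≫ ((ρ_ A).inv ≫ A ◁ s) ▷ E) := by
    have := (isPure_adjoin hc hprod (hΨ.comp_iso hc (β_ A E)) hs).comp_iso hc (β_ E (A ⊗ B))
    rwa [Category.assoc, BraidedCategory.braiding_naturality_right, Category.assoc,
      SymmetricCategory.symmetry_assoc] at this
  have hπ : ((ρ_ A).inv ≫ A ◁ s) ≫ A ◁ discard hc B ≫ (ρ_ A).hom = 𝟙 A := by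
    have : s ≫ discard hc B = 𝟙 _ := by
      rw [IsDeterministic.comp_discard hc hs.1, discard_unit]
    rw [Category.assoc, ← whiskerLeft_comp_assoc, this]
    simp
  generalize (ρ_ A).inv ≫ A ◁ s = j at *
  generalize A ◁ discard hc B ≫ (ρ_ A).hom = π at *
  have hmarg : ∀ f : A ⟶ A ⊗ B,
      (Ψ ≫ f ▷ E) ≫ (A ⊗ B) ◁ discard hc E = (μ ≫ f) ≫ (ρ_ (A ⊗ B)).inv := by
    intro f
    rw [Category.assoc, ← whisker_exchange, reassoc_of% hΨμ, ← rightUnitor_inv_naturality,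
      Category.assoc]
  obtain ⟨D, -, hD⟩ := exists_channel hc hcontrol hclosed hnores hfin hprod hpur
    (X := A ⊗ B) (Φ := Ψ ≫ (j ≫ C.hom) ▷ E) hpure
    (by
      rw [comp_whiskerRight, ← Category.assoc]
      exact IsDeterministic.comp hpure.1 ((IsDeterministic.of_iso hc C).whiskerRight E))
    (by rw [hmarg, hmarg, hC])
  -- The channel on `E` commutes past `j`, so the output on `Ψ` again has `s` adjoined last;
  -- discarding and re-adjoining `s` by `π ≫ j` leaves it unchanged.
  have hD' : Ψ ≫ (j ≫ C.hom) ▷ E = (Ψ ≫ A ◁ D) ≫ j ▷ E := by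
    rw [← hD, Category.assoc, Category.assoc, whisker_exchange]
  refine ⟨j ≫ C.hom ≫ π, hom_ext_of_faithful hc hcontrol hclosed hnores hfin hprod hpur
    hφ₀ hφ₁ hd₀ hd₁ hμ hΨ hΨμ ?_⟩
  have h1 : (j ≫ C.hom ≫ π) ≫ j = (j ≫ C.hom) ≫ π ≫ j := by simp only [Category.assoc]
  rw [h1, comp_whiskerRight (j ≫ C.hom), ← Category.assoc, hD', Category.assoc,
    ← comp_whiskerRight, ← Category.assoc j, hπ, Category.id_comp]

end

end OperationalTheory

/-! ### Assembly of the lemma -/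

open OperationalTheory in
theorem mainTheorem2 (𝒞 : Type u) [CategoryTheory.Category.{v} 𝒞]
    [CategoryTheory.MonoidalCategory 𝒞] [CategoryTheory.SymmetricCategory 𝒞]
    [OperationalTheory 𝒞]
    (hfin : OperationalTheory.FiniteDimensionalStates 𝒞)
    (hclosed : OperationalTheory.ClosedStates 𝒞)
    (hcontrol : OperationalTheory.ClassicalControl 𝒞)
    (hnores : OperationalTheory.NoRestriction 𝒞)
    (hprod : OperationalTheory.PureProducts 𝒞)
    (hcausal : OperationalTheory.Causal 𝒞)
    (hpur : OperationalTheory.Purification 𝒞)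
    (hsymm : OperationalTheory.StrongSymmetry 𝒞)
    (A B : 𝒞) (ι : Type) [Finite ι] (i : ι → (𝟙_ 𝒞 ⟶ A))
    (hi : OperationalTheory.IsMaximalPureDistinguishable i)
    (T : ι → (B ⟶ B)) (C : A ⊗ B ≅ A ⊗ B)
    (hC : OperationalTheory.IsControlled i T C.hom)
    (s : 𝟙_ 𝒞 ⟶ B) (hs : OperationalTheory.IsPure s) (hTs : ∀ k, s ≫ T k = s) :
    ∃ Q : A ≅ A,
      (∀ σ : 𝟙_ 𝒞 ⟶ A, OperationalTheory.IsState σ →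
        OperationalTheory.prodState σ s ≫ C.hom =
          OperationalTheory.prodState (σ ≫ Q.hom) s) ∧
      ∀ e : ι → (A ⟶ 𝟙_ 𝒞), OperationalTheory.Distinguishes e i →
        OperationalTheory.IsPhaseTransformation e Q := by
  classical
  have := Fintype.ofFinite ι
  have hprodState : ∀ σ : 𝟙_ 𝒞 ⟶ A, prodState σ s = σ ≫ (ρ_ A).inv ≫ A ◁ s := fun σ =>
    prodState_eq σ s
  have hCi : ∀ k, i k ≫ ((ρ_ A).inv ≫ A ◁ s) ≫ C.hom = i k ≫ (ρ_ A).inv ≫ A ◁ s := by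
    intro k
    have := hC k s hs.1
    rwa [hTs, hprodState, Category.assoc] at this
  obtain ⟨d, v, hv⟩ := exists_coordinates hcausal hcontrol hclosed hnores hfin A
  obtain ⟨u, -, hu⟩ := hv.exists_unit hcausal
  by_cases hnt : (stateBody v).Nontrivial
  swap
  -- With at most one state there is no distinguishable pair to build flags from. Then `Q` is the
  -- identity, and an empty control set is excluded because the only state could be added to it.
  · rw [Set.not_nontrivial_iff] at hnt
    refine ⟨Iso.refl A, fun σ hσ => ?_, fun e _ k => Category.id_comp _⟩
    have huniq : ∀ τ, IsState τ → τ = σ := fun τ hτ =>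
      hv.injective (hnt ⟨τ, hτ, rfl⟩ ⟨σ, hσ, rfl⟩)
    rcases isEmpty_or_nonempty ι with hι | ⟨⟨k⟩⟩
    · exfalso
      have hσp : IsPure σ := hv.isPure_of_extreme hcausal hcontrol hclosed hσ
        ⟨⟨σ, hσ, rfl⟩, fun x hx _ _ _ => hnt hx ⟨σ, hσ, rfl⟩⟩
      refine hi.2 ⟨σ, hv.distinguishable_of_functionals (fun _ => u) (fun x hx => ?_) _ ?_ ?_⟩
      · simp [hu x hx]
      · rintro (_ | k)
        · exact hσp
        · exact hι.elim k
      · rintro (_ | j) (_ | k)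
        · simpa using hu _ ⟨σ, hσ, rfl⟩
        all_goals exact isEmptyElim ‹ι›
    · rw [Iso.refl_hom, Category.comp_id, ← huniq (i k) (hi.1.1 k).1, hprodState,
        Category.assoc, hCi]
  obtain ⟨K, hK⟩ := ConvexBody.exists_isSelfDualizing hv.compact hv.convex hv.span_eq_top u hu hnt
    (hv.transitiveOnExtreme hcausal hcontrol hclosed hsymm)
    (hv.bitSymmetric hcausal hcontrol hclosed hsymm)
  obtain ⟨c, hc0, _, ⟨μ, hμs, rfl⟩, hKu⟩ := hK.exists_repr u fun x hx => by
    rw [hu x hx]; exact zero_le_one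
  have hμ := exists_isCompletelyMixed hv hK hu hKu.symm hμs rfl
  obtain ⟨φ₀, φ₁, hφ₀, hφ₁, d₀, hd₀, hd₁⟩ :=
    exists_flag hv hcausal hcontrol hclosed hnt hK hu
  have hcomp := hasCompressions hv hcausal hcontrol hclosed hnores hfin hprod hpur hu
    hφ₀ hφ₁ hd₀ hd₁ hμ
  have hsum := sum_maximal_eq hv hcausal hcontrol hclosed hnores hK hu hKu.symm hcomp hi
  have hcpos : c ≠ 0 := by
    rintro rfl
    have := hu _ ⟨μ, hμs, rfl⟩
    rw [hKu, zero_smul, map_zero, LinearMap.zero_apply] at this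
    exact zero_ne_one this
  -- `c • v μ` is the sum of the control states, so agreement on these passes to `μ`.
  have hlin : ∀ {D : 𝒞} (f g : A ⟶ D), (∀ k, i k ≫ f = i k ≫ g) → μ ≫ f = μ ≫ g := by
    intro D f g hfg
    refine state_ext fun e => ?_
    obtain ⟨a, ha⟩ := hv.exists_functional (f ≫ e)
    obtain ⟨b, hb⟩ := hv.exists_functional (g ≫ e)
    have h1 : a (c • v μ) = b (c • v μ) := by
      rw [← hsum, map_sum, map_sum]
      refine Finset.sum_congr rfl fun k _ => ?_
      rw [ha, hb, ← Category.assoc, hfg, Category.assoc]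
    rw [map_smul, map_smul, ha, hb] at h1
    rw [Category.assoc, Category.assoc]
    exact mul_left_cancel₀ hcpos h1
  obtain ⟨Q, hQ⟩ := exists_kickback hcausal hcontrol hclosed hnores hfin hprod hpur
    hφ₀.1 hφ₁ hd₀ hd₁ hμ hs C (hlin _ _ hCi)
  obtain ⟨Q', hQ'⟩ := exists_kickback hcausal hcontrol hclosed hnores hfin hprod hpur
    hφ₀.1 hφ₁ hd₀ hd₁ hμ hs C.symm (hlin _ _ fun k => by
      conv_lhs => rw [← Category.assoc, ← hCi k]
      simp)
  have hπ : ((ρ_ A).inv ≫ A ◁ s) ≫ A ◁ discard hcausal B ≫ (ρ_ A).hom = 𝟙 A := by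
    have : s ≫ discard hcausal B = 𝟙 _ := by
      rw [IsDeterministic.comp_discard hcausal hs.1, discard_unit]
    rw [Category.assoc, ← whiskerLeft_comp_assoc, this]
    simp
  rw [Iso.symm_hom] at hQ'
  generalize (ρ_ A).inv ≫ A ◁ s = j at *
  generalize A ◁ discard hcausal B ≫ (ρ_ A).hom = π at *
  -- Adjoining `s` is split by discarding `B`, so the kick-backs of `C` and of its inverse are
  -- mutually inverse.
  have hcancel : ∀ {X : 𝒞} {f g : X ⟶ A}, f ≫ j = g ≫ j → f = g := by
    intro X f g h
    have := congrArg (· ≫ π) h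
    simpa only [Category.assoc, hπ, Category.comp_id] using this
  let U : A ≅ A := ⟨Q, Q', hcancel (by
      rw [Category.assoc, hQ', reassoc_of% hQ, C.hom_inv_id, Category.comp_id,
        Category.id_comp]), hcancel (by
      rw [Category.assoc, hQ, reassoc_of% hQ', C.inv_hom_id, Category.comp_id,
        Category.id_comp])⟩
  refine ⟨U, fun σ _ => ?_, fun e he k => ?_⟩
  · rw [hprodState, hprodState, Category.assoc, Category.assoc, ← hQ]
  · have hiQ : ∀ k, i k ≫ Q = i k := fun k => hcancel (by rw [Category.assoc, hQ, hCi])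
    have hext := fun k => hv.extreme_of_isPure hcausal hcontrol hnores (hi.1.1 k)
    -- Values on the control states alone determine such an effect, though these states need not
    -- span; it applies to `e k` and to `U.hom ≫ e k`.
    have huniq : ∀ f : A ⟶ 𝟙_ 𝒞, (∀ l, prob (i l ≫ f) = if l = k then 1 else 0) →
        ∀ r, prob (r ≫ f) = K (v (i k)) (v r) := by
      intro f hf r
      obtain ⟨a, ha⟩ := hv.exists_functional f
      have : a = K (v (i k)) := by
        refine hK.eq_of_apply_eq_one hu hKu.symm (hext k) a ?_ ?_ ?_
        · rintro _ ⟨τ, -, rfl⟩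
          rw [ha]
          exact prob_nonneg _
        · rw [← hsum, map_sum]
          simp only [ha, hf, Finset.sum_ite_eq', Finset.mem_univ, if_true]
        · rw [ha, hf, if_pos rfl]
      rw [← this, ha]
    have hek : ∀ l, prob (i l ≫ e k) = if l = k then 1 else 0 := by
      intro l
      split_ifs with hlk
      · rw [hlk, he.2.1]
      · exact he.2.2 l k hlk
    refine effect_ext fun r => ?_
    rw [huniq _ hek, huniq (U.hom ≫ e k) fun l => ?_]
    rw [← Category.assoc, hiQ, hek]
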